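/- For a non-zero $Q\in\mathbb{Z}[T]$, the height $H(Q)$ is the maximum of the absolute values of the coefficients of $Q$ divided by their greatest common divisor; $Q$ is called primary if $Q=R^k$ for some irreducible element $R$ of the ring $\mathbb{Z}[T]$ and some integer $k\ge 1$. Let $\xi\in\mathbb{C}$ be a transcendental number, and let $\alpha,\beta,\mu,\omega\in\mathbb{R}$ with $\alpha\ge\mu>0$, $\beta\ge\alpha+\mu$ and $\omega>\alpha+\beta+\tfrac32\mu$. Then, for infinitely many positive integers $n$, there exists no primary polynomial $Q\in\mathbb{Z}[T]$, having no complex root that is $0$ or a root of unity, which satisfies $\deg(Q)\le n^\alpha$, $H(Q)\le\exp(n^\beta)$ and $$\prod_{a\in A}\prod_{b\in B}\bigl|Q(\xi^{ab})\bigr|\le\exp(-n^\omega)$$ for some non-empty subsets $A$ and $B$ of $\{1,2,\dots,\lfloor n^{\mu/2}\rfloor\}$. -/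

import Mathlib

open Polynomial

noncomputable section

/-- The height of a polynomial with integer coefficients: the maximum of the absolute values of its
coefficients divided by the greatest common divisor of its coefficients (only meaningful for
non-zero polynomials). -/
def intPolyHeight (Q : ℤ[X]) : ℝ := Q.supNorm / (Q.content : ℝ)

/-- A polynomial of `ℤ[T]` is primary if it is a (positive) power of an irreducible element of
the ring `ℤ[T]`. -/
def IsPrimaryPoly (Q : ℤ[X]) : Prop :=
  ∃ (R : ℤ[X]) (k : ℕ), Irreducible R ∧ 0 < k ∧ Q = R ^ k

/-- `Q` has no complex root which is zero or a root of unity. -/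
def NoTorsionOrZeroRoot (Q : ℤ[X]) : Prop :=
  ∀ z : ℂ, (z = 0 ∨ ∃ k : ℕ, 0 < k ∧ z ^ k = 1) → aeval z Q ≠ 0

end

/-!
The proof combines a determinantal estimate for resultants with Gel'fond's transcendence criterion.
Write `D = n ^ α`, `h = n ^ β`, `M = n ^ (μ / 2)` and `L = n ^ ω`.

*Resultants.* If integer polynomials `F` and `G` have no common root, their Sylvester matrix has a
nonzero integer determinant. Replacing some of its rows by evaluations at points `x i` multiplies
this determinant by a Vandermonde determinant, and bounding the new determinant by the `ℓ¹`-norms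
of its rows shows that `F` and `G` cannot be simultaneously small at many well separated points
(`prod_sub_le_of_resultant_ne_zero`).

*Concentration.* Suppose that `∏ |Q (ξ ^ (a * b))| ≤ exp (-L)`. As `Q` is a power of an irreducible
polynomial without zero or torsion roots, `Q (T ^ b)` and `Q (T ^ b')` have no common root for
`b ≠ b'` (`aeval_pow_ne_zero_of_aeval_pow_eq_zero`), so the resultant estimate at the points
`ξ ^ a` bounds the overlap of any two columns of the matrix `-log |Q (ξ ^ (a * b))|` by
`O(D * M * h)` (`sum_min_neg_log_le`). The points are far enough apart because the resultant of
`T ^ k - 1` with a `Q (T ^ q)` that is small at `ξ` is nonzero (`exp_neg_le_norm_pow_sub_one`). The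
total overlap is `O(D * M ^ 3 * h)`, which is negligible against `L` as `ω > α + β + 3 * μ / 2`.
So most of the mass of the matrix lies in one entry per row, and some entry is at least
`L / (2 * M)` (`exists_le_neg_log_of_prod_le`).

*Gel'fond's criterion.* The polynomial `Q (T ^ (a * b))` for this entry has degree at most
`D * M ^ 2`, logarithmic length `O(h)`, and a value at `ξ` of size at most `exp (-L / (2 * M))`,
where `L / M` is larger than `D * M ^ 2 * h` by a positive power of `n`. It has an irreducible
factor that is equally small relative to its degree and Mahler measure. If this happened for all
large `n`, the factors for `n` and `n + 1` would be associated by the resultant estimate at the point `ξ`, so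
all of them would be equal up to sign, and their common value at `ξ` would have to be zero
(`false_of_irreducible_sequence`).
-/

/-! ### Determinants and lengths of polynomials -/

/-- The determinant of a complex matrix is at most the product of the `ℓ¹`-norms of its rows. -/
lemma norm_det_le_prod_sum_norm {ι : Type*} [Fintype ι] [DecidableEq ι] (A : Matrix ι ι ℂ) :
    ‖A.det‖ ≤ ∏ i, ∑ j, ‖A i j‖ := by
  rw [← Matrix.det_transpose, Matrix.det_apply]
  refine (norm_sum_le _ _).trans ?_
  rw [Finset.prod_univ_sum]
  have h : ∀ σ : Equiv.Perm ι, ‖Equiv.Perm.sign σ • ∏ i, A.transpose (σ i) i‖ =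
      ∏ i, ‖A i (σ i)‖ := by
    intro σ
    rcases Int.units_eq_one_or (Equiv.Perm.sign σ) with h | h <;> simp [h]
  simp_rw [h]
  rw [← Finset.sum_image (s := Finset.univ) (g := fun σ : Equiv.Perm ι ↦ (σ : ι → ι))
    (f := fun p ↦ ∏ i, ‖A i (p i)‖) (fun σ _ τ _ h ↦ DFunLike.coe_injective h)]
  exact Finset.sum_le_sum_of_subset_of_nonneg (fun p _ ↦ by simp)
    fun p _ _ ↦ Finset.prod_nonneg fun _ _ ↦ norm_nonneg _

/-- The length of an integer polynomial: the sum of the absolute values of its coefficients. -/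
noncomputable def polyLength (P : ℤ[X]) : ℝ := ∑ k ∈ P.support, ‖P.coeff k‖

lemma one_le_polyLength {P : ℤ[X]} (hP : P ≠ 0) : 1 ≤ polyLength P := by
  have h := Finset.single_le_sum (f := fun k ↦ ‖P.coeff k‖) (fun _ _ ↦ norm_nonneg _)
    (natDegree_mem_support_of_nonzero hP)
  refine le_trans ?_ h
  have : (1 : ℤ) ≤ |P.leadingCoeff| := Int.one_le_abs (leadingCoeff_ne_zero.mpr hP)
  rw [Int.norm_eq_abs]
  exact_mod_cast this

lemma sum_norm_coeff_le_polyLength (P : ℤ[X]) (s : Finset ℕ) :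
    ∑ k ∈ s, ‖P.coeff k‖ ≤ polyLength P := by
  rw [← Finset.sum_filter_of_ne (p := fun k ↦ k ∈ P.support)]
  · exact Finset.sum_le_sum_of_subset_of_nonneg (fun k hk ↦ (Finset.mem_filter.mp hk).2)
      fun _ _ _ ↦ norm_nonneg _
  · intro k _ hk
    simpa using hk

/-- The entries of one row of a Sylvester matrix that come from `P` are distinct coefficients of
`P`, so their absolute values sum to at most the length of `P`. -/
lemma sum_shift_norm_coeff_le (P : ℤ[X]) (m n i : ℕ) :
    ∑ j : Fin m, ‖if i ∈ Set.Icc (j : ℕ) (j + n) then P.coeff (i - j) else 0‖ ≤ polyLength P := by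
  have h1 : ∀ j : Fin m, ‖if i ∈ Set.Icc (j : ℕ) (j + n) then P.coeff (i - j) else 0‖ ≤
      if (j : ℕ) ≤ i then ‖P.coeff (i - j)‖ else 0 := by
    intro j
    by_cases h : i ∈ Set.Icc (j : ℕ) (j + n)
    · rw [if_pos h, if_pos h.1]
    · rw [if_neg h, norm_zero]
      split_ifs <;> simp
  refine (Finset.sum_le_sum fun j _ ↦ h1 j).trans ?_
  rw [← Finset.sum_filter, ← Finset.sum_image (g := fun j : Fin m ↦ i - (j : ℕ))
    (f := fun k ↦ ‖P.coeff k‖)]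
  · exact sum_norm_coeff_le_polyLength P _
  · intro a ha b hb hab
    simp only [Finset.coe_filter, Finset.mem_univ, true_and, Set.mem_ofPred_eq] at ha hb
    have : i - (a : ℕ) = i - (b : ℕ) := hab
    exact Fin.ext (by omega)

/-- Multiplying the column of a Sylvester matrix that holds the coefficients of `X ^ j * P` by
the row of powers of `x` gives the value of `X ^ j * P` at `x`. -/
lemma sum_pow_mul_shift_coeff (P : ℤ[X]) (x : ℂ) {N n j : ℕ} (hP : P.natDegree ≤ n)
    (hj : j + n < N) :
    ∑ k : Fin N, x ^ (k : ℕ) *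
      ((if (k : ℕ) ∈ Set.Icc j (j + n) then P.coeff (k - j) else 0 : ℤ) : ℂ) =
      x ^ j * aeval x P := by
  rw [Fin.sum_univ_eq_sum_range (fun k : ℕ ↦ x ^ k *
    ((if k ∈ Set.Icc j (j + n) then P.coeff (k - j) else 0 : ℤ) : ℂ)) N]
  have h1 : ∀ k ∈ Finset.range N, x ^ k *
      ((if k ∈ Set.Icc j (j + n) then P.coeff (k - j) else 0 : ℤ) : ℂ) =
      if k ∈ Finset.Icc j (j + n) then x ^ k * (P.coeff (k - j) : ℂ) else 0 := by
    intro k _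
    simp only [Set.mem_Icc, Finset.mem_Icc]
    split_ifs <;> simp
  rw [Finset.sum_congr rfl h1, ← Finset.sum_filter, Finset.filter_mem_eq_inter,
    Finset.inter_eq_right.mpr (by intro k hk; simp at hk ⊢; omega),
    ← Finset.Ico_succ_right_eq_Icc, Finset.sum_Ico_eq_sum_range,
    aeval_eq_sum_range' (Nat.lt_succ_of_le hP), Finset.mul_sum]
  have : Order.succ (j + n) - j = n + 1 := by simp only [Nat.succ_eq_succ]; omega
  rw [this]
  refine Finset.sum_congr rfl fun k _ ↦ ?_
  rw [Nat.add_sub_cancel_left, pow_add, zsmul_eq_mul]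
  ring

/-! ### Resultants and values at several points -/

/-- Rows of powers of the points `x i`, completed by the last rows of an identity matrix. -/
noncomputable def evalRows {s : ℕ} (t N : ℕ) (x : Fin s → ℂ) :
    Matrix (Fin s ⊕ Fin t) (Fin N) ℂ :=
  .of fun (p : Fin s ⊕ Fin t) (k : Fin N) ↦
    Sum.elim (fun i : Fin s ↦ x i ^ (k : ℕ))
      (fun l : Fin t ↦ if s + (l : ℕ) = (k : ℕ) then (1 : ℂ) else 0) p

lemma det_evalRows {s t N : ℕ} (h : s + t = N) (x : Fin s → ℂ) :
    ((evalRows t N x).submatrix id (finSumFinEquiv.trans (finCongr h))).det =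
      (Matrix.vandermonde x).det := by
  have : (evalRows t N x).submatrix id (finSumFinEquiv.trans (finCongr h)) =
      Matrix.fromBlocks (Matrix.vandermonde x)
        (.of fun i (l : Fin t) ↦ x i ^ (s + (l : ℕ))) 0 1 := by
    ext (p | p) (q | q)
    · simp [evalRows, Matrix.vandermonde]
    · simp [evalRows]
    · simp only [evalRows, Matrix.submatrix_apply, id_eq, Equiv.trans_apply,
        finSumFinEquiv_apply_left, finCongr_apply, Matrix.of_apply, Sum.elim_inr, Fin.val_cast,
        Fin.val_castAdd, Matrix.fromBlocks_apply₂₁, Matrix.zero_apply, ite_eq_right_iff]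
      have := q.2
      omega
    · simp [evalRows, Matrix.one_apply, Fin.ext_iff]
  rw [this, Matrix.det_fromBlocks_zero₂₁, Matrix.det_one, mul_one]

/-- **Resultants and small values at several points.** If the resultant of `F` and `G` does not
vanish, then `F` and `G` cannot be simultaneously small at many well separated points: the
Vandermonde product of the points bounds from below the product of the values `v i`. The formal
degrees `m` and `n` may exceed the degrees of `F` and `G`, which leaves room for more points. -/
theorem prod_sub_le_of_resultant_ne_zero {F G : ℤ[X]} (hF0 : F ≠ 0) (hG0 : G ≠ 0) {m n : ℕ}
    (hF : F.natDegree ≤ m) (hG : G.natDegree ≤ n) (hres : resultant F G m n ≠ 0)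
    {s : ℕ} (hs : s ≤ m + n) (x : Fin s → ℂ) (v : Fin s → ℝ)
    (hFv : ∀ i, ‖aeval (x i) F‖ ≤ v i) (hGv : ∀ i, ‖aeval (x i) G‖ ≤ v i)
    {R : ℝ} (hR : 1 ≤ R) (hx : ∀ i, ‖x i‖ ≤ R) :
    ∏ i, ∏ j ∈ Finset.Ioi i, ‖x j - x i‖ ≤
      polyLength F ^ n * polyLength G ^ m * 2 ^ (m + n) *
        ∏ i, ((m + n : ℕ) * R ^ (m + n) * v i) := by
  obtain ⟨t, ht⟩ := Nat.exists_eq_add_of_le hs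
  have h : s + t = m + n := ht.symm
  have hLF := one_le_polyLength hF0
  have hLG := one_le_polyLength hG0
  set e : Fin s ⊕ Fin t ≃ Fin (m + n) := finSumFinEquiv.trans (finCongr h) with he
  let S : Matrix (Fin (m + n)) (Fin (m + n)) ℂ := (sylvester F G m n).map (Int.castRingHom ℂ)
  let c : Fin (m + n) → ℂ :=
    Fin.addCases (fun _ ↦ ((polyLength G)⁻¹ : ℂ)) (fun _ ↦ ((polyLength F)⁻¹ : ℂ))
  -- evaluations replace the first rows, and the columns are scaled by the lengths
  let B : Matrix (Fin s ⊕ Fin t) (Fin (m + n)) ℂ :=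
    .of fun p j ↦ c j * (evalRows t (m + n) x * S) p j
  have hdetS : S.det = ((resultant F G m n : ℤ) : ℂ) := by
    have := (Int.castRingHom ℂ).map_det (sylvester F G m n)
    exact this.symm
  have hdet : (B.submatrix id e).det =
      (∏ j, c j) * ((Matrix.vandermonde x).det * ((resultant F G m n : ℤ) : ℂ)) := by
    have h1 : B.submatrix id e = .of fun p q ↦ (c ∘ e) q *
        ((evalRows t (m + n) x).submatrix id e * S.submatrix e e) p q := by
      ext p q
      rw [← Matrix.submatrix_mul (evalRows t (m + n) x) S id e e e.bijective]
      rfl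
    rw [h1, Matrix.det_mul_row, Matrix.det_mul, det_evalRows, Matrix.det_submatrix_equiv_self,
      hdetS]
    congr 1
    exact e.prod_comp c
  have hc : ‖∏ j, c j‖ = (polyLength G)⁻¹ ^ m * (polyLength F)⁻¹ ^ n := by
    rw [Fin.prod_univ_add]
    simp [c, abs_of_pos (zero_lt_one.trans_le hLF), abs_of_pos (zero_lt_one.trans_le hLG)]
  -- an entry in an evaluation row is a scaled value of `X ^ j * F` or `X ^ j * G`
  have hBl : ∀ i j, ‖B (Sum.inl i) j‖ ≤ R ^ (m + n) * v i := by
    intro i j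
    have hvi : 0 ≤ v i := (norm_nonneg _).trans (hFv i)
    have key : ∀ (a : ℕ) (P : ℤ[X]) (ℓ : ℝ), 1 ≤ ℓ → a ≤ m + n → ‖aeval (x i) P‖ ≤ v i →
        ‖((ℓ⁻¹ : ℝ) : ℂ) * (x i ^ a * aeval (x i) P)‖ ≤ R ^ (m + n) * v i := by
      intro a P ℓ hℓ ha hP
      rw [norm_mul, norm_mul, norm_pow, Complex.norm_real, Real.norm_eq_abs,
        abs_of_pos (inv_pos.mpr (zero_lt_one.trans_le hℓ))]
      have h2 : ‖x i‖ ^ a ≤ R ^ (m + n) :=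
        (pow_le_pow_left₀ (norm_nonneg _) (hx i) a).trans (pow_le_pow_right₀ hR ha)
      calc ℓ⁻¹ * (‖x i‖ ^ a * ‖aeval (x i) P‖) ≤ 1 * (R ^ (m + n) * v i) := by
            gcongr
            exact inv_le_one_of_one_le₀ hℓ
        _ = _ := one_mul _
    refine Fin.addCases (fun j ↦ ?_) (fun j ↦ ?_) j
    · have h3 : B (Sum.inl i) (Fin.castAdd n j) =
          (((polyLength G)⁻¹ : ℝ) : ℂ) * (x i ^ (j : ℕ) * aeval (x i) G) := by
        rw [← sum_pow_mul_shift_coeff G (x i) (N := m + n) hG (by have := j.2; omega)]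
        simp only [B, c, Matrix.of_apply, Fin.addCases_left, Matrix.mul_apply, S, evalRows,
          Sum.elim_inl, Matrix.map_apply, sylvester, Complex.ofReal_inv]
        rfl
      rw [h3]
      exact key _ _ _ hLG (by have := j.2; omega) (hGv i)
    · have h3 : B (Sum.inl i) (Fin.natAdd m j) =
          (((polyLength F)⁻¹ : ℝ) : ℂ) * (x i ^ (j : ℕ) * aeval (x i) F) := by
        rw [← sum_pow_mul_shift_coeff F (x i) (N := m + n) hF (by have := j.2; omega)]
        simp only [B, c, Matrix.of_apply, Fin.addCases_right, Matrix.mul_apply, S, evalRows,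
          Sum.elim_inl, Matrix.map_apply, sylvester, Complex.ofReal_inv]
        rfl
      rw [h3]
      exact key _ _ _ hLF (by have := j.2; omega) (hFv i)
  -- the other rows consist of coefficients, scaled so that `F` and `G` contribute at most `1` each
  have hBr : ∀ l, ∑ j, ‖B (Sum.inr l) j‖ ≤ 2 := by
    intro l
    have h4 : ∀ j, B (Sum.inr l) j = c j * ((sylvester F G m n (e (Sum.inr l)) j : ℤ) : ℂ) := by
      intro j
      simp only [B, Matrix.of_apply, Matrix.mul_apply, evalRows, Sum.elim_inr]
      rw [Finset.sum_eq_single (e (Sum.inr l))]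
      · simp [he, S]
      · intro k _ hk
        rw [if_neg, zero_mul]
        intro h5
        apply hk
        ext
        simp [he, ← h5]
      · simp
    simp_rw [h4, norm_mul, Complex.norm_intCast]
    rw [Fin.sum_univ_add]
    have h5 := sum_shift_norm_coeff_le G m n (e (Sum.inr l))
    have h6 := sum_shift_norm_coeff_le F n m (e (Sum.inr l))
    simp only [c, Fin.addCases_left, Fin.addCases_right, sylvester, Matrix.of_apply, norm_inv,
      Complex.norm_real, Real.norm_eq_abs, abs_of_pos (zero_lt_one.trans_le hLF),
      abs_of_pos (zero_lt_one.trans_le hLG), ← Finset.mul_sum]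
    simp only [Int.norm_eq_abs] at h5 h6
    have h7 := mul_le_mul_of_nonneg_left h5 (inv_nonneg.mpr (zero_le_one.trans hLG))
    have h8 := mul_le_mul_of_nonneg_left h6 (inv_nonneg.mpr (zero_le_one.trans hLF))
    rw [inv_mul_cancel₀ (zero_lt_one.trans_le hLG).ne'] at h7
    rw [inv_mul_cancel₀ (zero_lt_one.trans_le hLF).ne'] at h8
    linarith
  have hB := norm_det_le_prod_sum_norm (B.submatrix id e)
  rw [hdet, norm_mul, norm_mul, hc, Fintype.prod_sum_type, Complex.norm_intCast] at hB
  have hres1 : (1 : ℝ) ≤ |((resultant F G m n : ℤ) : ℝ)| := by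
    exact_mod_cast Int.one_le_abs hres
  have hrow : ∀ p, ∑ q, ‖B.submatrix id e p q‖ = ∑ j, ‖B p j‖ := fun p ↦
    e.sum_comp fun j ↦ ‖B p j‖
  simp_rw [hrow] at hB
  have hA : ∏ i, ∑ j, ‖B (Sum.inl i) j‖ ≤ ∏ i, ((m + n : ℕ) * R ^ (m + n) * v i) := by
    refine Finset.prod_le_prod (fun i _ ↦ Finset.sum_nonneg fun _ _ ↦ norm_nonneg _) fun i _ ↦ ?_
    refine (Finset.sum_le_card_nsmul _ _ _ fun j _ ↦ hBl i j).trans ?_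
    simp [mul_assoc]
  have hA0 : 0 ≤ ∏ i, ∑ j, ‖B (Sum.inl i) j‖ :=
    Finset.prod_nonneg fun i _ ↦ Finset.sum_nonneg fun _ _ ↦ norm_nonneg _
  have hC : ∏ l, ∑ j, ‖B (Sum.inr l) j‖ ≤ 2 ^ (m + n) := by
    calc ∏ l, ∑ j, ‖B (Sum.inr l) j‖ ≤ ∏ _l : Fin t, (2 : ℝ) :=
          Finset.prod_le_prod (fun i _ ↦ Finset.sum_nonneg fun _ _ ↦ norm_nonneg _) fun l _ ↦ hBr l
      _ = 2 ^ t := by simp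
      _ ≤ 2 ^ (m + n) := pow_le_pow_right₀ (by norm_num) (by omega)
  have hV : ‖(Matrix.vandermonde x).det‖ = ∏ i, ∏ j ∈ Finset.Ioi i, ‖x j - x i‖ := by
    rw [Matrix.det_vandermonde]
    simp [norm_prod]
  rw [hV] at hB
  set V := ∏ i, ∏ j ∈ Finset.Ioi i, ‖x j - x i‖
  have hV0 : 0 ≤ V := Finset.prod_nonneg fun _ _ ↦ Finset.prod_nonneg fun _ _ ↦ norm_nonneg _
  have hpos : 0 < polyLength G ^ m * polyLength F ^ n := by positivity
  have h9 : (polyLength G)⁻¹ ^ m * (polyLength F)⁻¹ ^ n * V ≤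
      (∏ i, ((m + n : ℕ) * R ^ (m + n) * v i)) * 2 ^ (m + n) := by
    refine le_trans ?_ (hB.trans (mul_le_mul hA hC ?_ (hA0.trans hA)))
    · have : V ≤ V * |((resultant F G m n : ℤ) : ℝ)| := le_mul_of_one_le_right hV0 hres1
      gcongr
    · exact Finset.prod_nonneg fun i _ ↦ Finset.sum_nonneg fun _ _ ↦ norm_nonneg _
  rw [inv_pow, inv_pow, ← mul_inv, inv_mul_le_iff₀ hpos] at h9
  linarith [h9]

/-- The resultant is nonzero when `F` and `G` have no common complex root and the formal degree
of `G` is exact. -/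
lemma resultant_ne_zero_of_no_common_root {F G : ℤ[X]} (hG0 : G ≠ 0)
    (h : ∀ z : ℂ, aeval z F = 0 → aeval z G ≠ 0) {m : ℕ} (hF : F.natDegree ≤ m) :
    resultant F G m G.natDegree ≠ 0 := by
  obtain ⟨k, rfl⟩ := Nat.exists_eq_add_of_le hF
  rw [resultant_add_left_deg _ _ _ _ _ le_rfl]
  refine mul_ne_zero (mul_ne_zero (pow_ne_zero _ (by norm_num))
    (pow_ne_zero _ (by simpa using hG0))) ?_
  intro h0
  have hinj : Function.Injective (Int.castRingHom ℂ) := Int.cast_injective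
  have h1 : resultant (F.map (Int.castRingHom ℂ)) (G.map (Int.castRingHom ℂ)) = 0 := by
    rw [natDegree_map_eq_of_injective hinj, natDegree_map_eq_of_injective hinj,
      resultant_map_map, h0, map_zero]
  rw [resultant_eq_zero_iff] at h1
  apply h1.2
  rw [isCoprime_iff_aeval_ne_zero_of_isAlgClosed ℂ ℂ]
  intro z
  have := h z
  rw [← algebraMap_int_eq, aeval_map_algebraMap, aeval_map_algebraMap]
  tauto

/-! ### Conjugate powers and coprimality -/

lemma irreducible_map_rat {R : ℤ[X]} (hR : Irreducible R) (hd : R.natDegree ≠ 0) :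
    Irreducible (R.map (Int.castRingHom ℚ)) :=
  (IsPrimitive.Int.irreducible_iff_irreducible_map_cast (hR.isPrimitive hd)).mp hR

lemma isConjRoot_of_irreducible {K : Type*} [Field K] [Algebra ℚ K] {R : ℤ[X]}
    (hR : Irreducible R) (hd : R.natDegree ≠ 0) {x y : K} (hx : aeval x R = 0)
    (hy : aeval y R = 0) : IsConjRoot ℚ x y := by
  have h := irreducible_map_rat hR hd
  have h1 : aeval x (R.map (Int.castRingHom ℚ)) = 0 := by
    rwa [← algebraMap_int_eq, aeval_map_algebraMap]
  have h2 : aeval y (R.map (Int.castRingHom ℚ)) = 0 := by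
    rwa [← algebraMap_int_eq, aeval_map_algebraMap]
  rw [IsConjRoot, ← minpoly.eq_of_irreducible h h1, ← minpoly.eq_of_irreducible h h2]

/-- If two different powers `z ^ a` and `z ^ b` are conjugate over `ℚ`, then they are zero or roots
of unity: an automorphism `σ` with `σ (z ^ a) = z ^ b` satisfies
`(σ ^ k y) ^ (a ^ k) = y ^ (b ^ k)` for `y = z ^ a`, and some positive power of `σ` fixes `y`. -/
lemma eq_zero_or_torsion_of_isConjRoot {K : Type*} [Field K] [Algebra ℚ K] [Normal ℚ K] {z : K}
    {a b : ℕ} (hab : a ≠ b) (h : IsConjRoot ℚ (z ^ b) (z ^ a)) :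
    z ^ a = 0 ∨ ∃ k : ℕ, 0 < k ∧ (z ^ a) ^ k = 1 := by
  obtain ⟨σ, hσ⟩ := isConjRoot_iff_exists_algEquiv.mp h
  set y := z ^ a with hy
  have hpow : ∀ k : ℕ, ((σ ^ k) y) ^ (a ^ k) = y ^ (b ^ k) := by
    intro k
    induction k with
    | zero => simp
    | succ k ih =>
      have h1 : (σ ^ (k + 1)) y = σ ((σ ^ k) y) := by rw [pow_succ']; rfl
      rw [h1, pow_succ, pow_mul, ← map_pow, ih, map_pow, hσ, ← pow_mul, mul_comm, pow_mul,
        pow_succ', pow_mul, ← pow_mul z b a, mul_comm b a, pow_mul z a b]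
  have hnot : ¬ Function.Injective fun k : ℕ ↦ (σ ^ k) y := by
    intro hinj
    have hfin : (Set.range fun k : ℕ ↦ (σ ^ k) y).Finite := by
      refine ((minpoly ℚ y).rootSet_finite K).subset ?_
      rintro _ ⟨k, rfl⟩
      rw [mem_rootSet]
      refine ⟨minpoly.ne_zero (Normal.isIntegral inferInstance y), ?_⟩
      change aeval ((σ ^ k) y) (minpoly ℚ y) = 0
      rw [aeval_algHom_apply (σ ^ k) y, minpoly.aeval, map_zero]
    exact Set.infinite_range_of_injective hinj hfin
  obtain ⟨N, hN, hfix⟩ : ∃ N : ℕ, 0 < N ∧ (σ ^ N) y = y := by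
    simp only [Function.Injective, not_forall] at hnot
    obtain ⟨i, j, hij, hne⟩ := hnot
    wlog hlt : i < j generalizing i j
    · exact this j i hij.symm (Ne.symm hne) (by omega)
    refine ⟨j - i, by omega, ?_⟩
    apply (σ ^ i).injective
    have h1 : (σ ^ i) ((σ ^ (j - i)) y) = (σ ^ j) y := by
      rw [← AlgEquiv.mul_apply, ← pow_add, Nat.add_sub_cancel' hlt.le]
    rw [h1]
    exact hij.symm
  have hk := hpow N
  rw [hfix] at hk
  have hne : a ^ N ≠ b ^ N := fun h ↦ hab (Nat.pow_left_injective hN.ne' h)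
  rcases eq_or_ne y 0 with h0 | h0
  · exact Or.inl h0
  right
  clear_value y
  generalize a ^ N = p at hk hne
  generalize b ^ N = q at hk hne
  wlog hlt : p < q generalizing p q
  · exact this q p hk.symm (Ne.symm hne) (by omega)
  refine ⟨q - p, by omega, ?_⟩
  obtain ⟨d, rfl⟩ := Nat.exists_eq_add_of_le hlt.le
  rw [Nat.add_sub_cancel_left]
  rw [pow_add] at hk
  exact (mul_eq_left₀ (pow_ne_zero _ h0)).mp hk.symm

/-- For a primary polynomial without zero or torsion roots, `Q (T ^ a)` and `Q (T ^ b)` have no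
common root when `a ≠ b`. -/
lemma aeval_pow_ne_zero_of_aeval_pow_eq_zero {Q : ℤ[X]} (hQ : IsPrimaryPoly Q)
    (ht : NoTorsionOrZeroRoot Q) (hd : Q.natDegree ≠ 0) {a b : ℕ} (ha : 0 < a) (hab : a ≠ b)
    {z : ℂ} (hz : aeval (z ^ a) Q = 0) : aeval (z ^ b) Q ≠ 0 := by
  intro hzb
  obtain ⟨R, k, hR, hk, rfl⟩ := hQ
  have hRd : R.natDegree ≠ 0 := by
    rintro h
    exact hd (by rw [natDegree_pow, h, mul_zero])
  have hza : aeval (z ^ a) R = 0 := by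
    rw [map_pow] at hz
    exact pow_eq_zero_iff hk.ne' |>.mp hz
  replace hzb : aeval (z ^ b) R = 0 := by
    rw [map_pow] at hzb
    exact pow_eq_zero_iff hk.ne' |>.mp hzb
  have halg : IsAlgebraic ℚ z := by
    refine IsAlgebraic.of_pow ha
      ⟨R.map (Int.castRingHom ℚ), (irreducible_map_rat hR hRd).ne_zero, ?_⟩
    rwa [← algebraMap_int_eq, aeval_map_algebraMap]
  let w : algebraicClosure ℚ ℂ := ⟨z, mem_algebraicClosure_iff.mpr halg⟩
  have hw : ∀ j : ℕ, ((w ^ j : algebraicClosure ℚ ℂ) : ℂ) = z ^ j := fun j ↦ by simp [w]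
  have hroot : ∀ j : ℕ, aeval (z ^ j) R = 0 → aeval (w ^ j) R = 0 := by
    intro j hj
    apply Subtype.val_injective
    rw [← hw j] at hj
    have := aeval_algebraMap_apply ℂ (w ^ j) R
    exact this.symm.trans hj
  have hnorm : Normal ℚ (algebraicClosure ℚ ℂ) :=
    @IsAlgClosure.normal _ _ _ _ _ (algebraicClosure.isAlgClosure ℚ ℂ)
  rcases eq_zero_or_torsion_of_isConjRoot hab
    (isConjRoot_of_irreducible hR hRd (hroot b hzb) (hroot a hza)) with h | ⟨k, hk, h⟩
  · exact ht (z ^ a) (Or.inl (by rw [← hw a, h]; rfl)) hz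
  · exact ht (z ^ a) (Or.inr ⟨k, hk, by rw [← hw a, ← SubmonoidClass.coe_pow, h]; rfl⟩) hz

lemma polyLength_expand_le (Q : ℤ[X]) {a : ℕ} (ha : 0 < a) :
    polyLength (expand ℤ a Q) ≤ polyLength Q := by
  have hdvd : ∀ k ∈ (expand ℤ a Q).support, a ∣ k := by
    intro k hk
    rw [mem_support_iff, coeff_expand ha] at hk
    by_contra h
    simp [h] at hk
  calc polyLength (expand ℤ a Q) = ∑ k ∈ (expand ℤ a Q).support, ‖Q.coeff (k / a)‖ :=
        Finset.sum_congr rfl fun k hk ↦ by rw [coeff_expand ha, if_pos (hdvd k hk)]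
    _ = ∑ k ∈ (expand ℤ a Q).support.image (· / a), ‖Q.coeff k‖ :=
        (Finset.sum_image (f := fun k ↦ ‖Q.coeff k‖) fun k hk l hl h ↦
          (Nat.div_left_inj (hdvd k hk) (hdvd l hl)).mp h).symm
    _ ≤ polyLength Q := sum_norm_coeff_le_polyLength Q _

lemma polyLength_le_of_supNorm (Q : ℤ[X]) : polyLength Q ≤ (Q.natDegree + 1) * Q.supNorm := by
  have h1 : polyLength Q ≤ ∑ k ∈ Finset.range (Q.natDegree + 1), Q.supNorm :=
    (Finset.sum_le_sum fun k _ ↦ Q.le_supNorm k).trans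
      (Finset.sum_le_sum_of_subset_of_nonneg supp_subset_range_natDegree_succ
        fun _ _ _ ↦ Q.supNorm_nonneg)
  simpa using h1

lemma isPrimitive_of_isPrimaryPoly {Q : ℤ[X]} (hQ : IsPrimaryPoly Q) (hd : Q.natDegree ≠ 0) :
    Q.IsPrimitive := by
  obtain ⟨R, k, hR, hk, rfl⟩ := hQ
  have hRd : R.natDegree ≠ 0 := by
    rintro h
    exact hd (by rw [natDegree_pow, h, mul_zero])
  clear hd hk
  induction k with
  | zero => simp
  | succ k ih => exact pow_succ R k ▸ IsPrimitive.mul ih (hR.isPrimitive hRd)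

lemma supNorm_eq_intPolyHeight {Q : ℤ[X]} (hQ : IsPrimaryPoly Q) (hd : Q.natDegree ≠ 0) :
    Q.supNorm = intPolyHeight Q := by
  rw [intPolyHeight, (isPrimitive_of_isPrimaryPoly hQ hd).content_eq_one]
  simp

lemma one_le_norm_aeval_of_natDegree_eq_zero {Q : ℤ[X]} (hQ : Q ≠ 0) (hd : Q.natDegree = 0)
    (x : ℂ) : 1 ≤ ‖aeval x Q‖ := by
  obtain ⟨c, rfl⟩ := natDegree_eq_zero.mp hd
  have hc : c ≠ 0 := by rintro rfl; simp at hQ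
  have : (1 : ℝ) ≤ |(c : ℝ)| := by exact_mod_cast Int.one_le_abs hc
  simpa using this

/-- Two irreducible non-constant integer polynomials with a common complex root are associated. -/
lemma associated_of_common_root {S T : ℤ[X]} (hS : Irreducible S) (hT : Irreducible T)
    (hSd : S.natDegree ≠ 0) (hTd : T.natDegree ≠ 0) {z : ℂ} (hzS : aeval z S = 0)
    (hzT : aeval z T = 0) : Associated S T := by
  have hS' := irreducible_map_rat hS hSd
  have hT' := irreducible_map_rat hT hTd
  have h1 : aeval z (S.map (Int.castRingHom ℚ)) = 0 := by
    rwa [← algebraMap_int_eq, aeval_map_algebraMap]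
  have h2 : aeval z (T.map (Int.castRingHom ℚ)) = 0 := by
    rwa [← algebraMap_int_eq, aeval_map_algebraMap]
  have h3 : S.map (Int.castRingHom ℚ) ∣ T.map (Int.castRingHom ℚ) := by
    have := minpoly.dvd ℚ z h2
    rw [← minpoly.eq_of_irreducible hS' h1] at this
    exact (dvd_mul_right _ _).trans this
  exact hS.associated_of_dvd hT
    ((IsPrimitive.Int.dvd_iff_map_cast_dvd_map_cast _ _
      (hS.isPrimitive hSd)).mpr h3)

/-! ### Logarithmic form of the resultant estimate -/

lemma one_le_prod_of_one_le {ι : Type*} (s : Finset ι) (f : ι → ℝ) (h : ∀ i ∈ s, 1 ≤ f i) :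
    1 ≤ ∏ i ∈ s, f i := by
  simpa using Finset.prod_le_prod (s := s) (f := fun _ ↦ (1 : ℝ)) (g := f) (by simp) h

/-- Logarithmic form of `prod_sub_le_of_resultant_ne_zero` for points at mutual distance at least
`exp (-Z)`. -/
lemma sum_neg_log_le_of_no_common_root {F G : ℤ[X]} (hF0 : F ≠ 0) (hG0 : G ≠ 0)
    (h : ∀ z : ℂ, aeval z F = 0 → aeval z G ≠ 0) {m : ℕ} (hF : F.natDegree ≤ m) {ι : Type*}
    (A : Finset ι) (hA : A.card ≤ m + G.natDegree) (hpos : 0 < m + G.natDegree)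
    (x : ι → ℂ) (v : ι → ℝ)
    (hv : ∀ i ∈ A, 0 < v i) (hFv : ∀ i ∈ A, ‖aeval (x i) F‖ ≤ v i)
    (hGv : ∀ i ∈ A, ‖aeval (x i) G‖ ≤ v i) {ρ Z : ℝ} (hρ : 0 ≤ ρ)
    (hx : ∀ i ∈ A, ‖x i‖ ≤ Real.exp ρ) (hZ : 0 ≤ Z)
    (hsep : ∀ i ∈ A, ∀ j ∈ A, i ≠ j → Real.exp (-Z) ≤ ‖x j - x i‖) :
    ∑ i ∈ A, -Real.log (v i) ≤
      G.natDegree * Real.log (polyLength F) + m * Real.log (polyLength G) + (m + G.natDegree) +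
        A.card * ((m + G.natDegree) * (1 + ρ)) + A.card ^ 2 * Z := by
  set n := G.natDegree with hn
  set s := A.card with hs
  let e := A.equivFin
  have key := prod_sub_le_of_resultant_ne_zero hF0 hG0 hF hn.ge
    (resultant_ne_zero_of_no_common_root hG0 h hF) (s := s) hA
    (fun i ↦ x (e.symm i)) (fun i ↦ v (e.symm i)) (fun i ↦ hFv _ (e.symm i).2)
    (fun i ↦ hGv _ (e.symm i).2) (Real.one_le_exp hρ) (fun i ↦ hx _ (e.symm i).2)
  have hre : ∏ i, ((m + n : ℕ) * Real.exp ρ ^ (m + n) * v (e.symm i)) =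
      ∏ i ∈ A, ((m + n : ℕ) * Real.exp ρ ^ (m + n) * v i) := by
    rw [← Finset.prod_coe_sort A]
    exact e.symm.prod_comp fun i : A ↦ ((m + n : ℕ) * Real.exp ρ ^ (m + n) * v i)
  rw [hre] at key
  have hlow : Real.exp (-(s ^ 2 * Z)) ≤
      ∏ i : Fin s, ∏ j ∈ Finset.Ioi i, ‖x (e.symm j) - x (e.symm i)‖ := by
    have h1 : ∀ i : Fin s, Real.exp (-(s * Z)) ≤
        ∏ j ∈ Finset.Ioi i, ‖x (e.symm j) - x (e.symm i)‖ := by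
      intro i
      have h2 : ∏ j ∈ Finset.Ioi i, Real.exp (-Z) ≤
          ∏ j ∈ Finset.Ioi i, ‖x (e.symm j) - x (e.symm i)‖ := by
        refine Finset.prod_le_prod (fun _ _ ↦ (Real.exp_pos _).le) fun j hj ↦ ?_
        refine hsep _ (e.symm i).2 _ (e.symm j).2 fun hij ↦ ?_
        have : i = j := e.symm.injective (Subtype.ext hij)
        exact (Finset.mem_Ioi.mp hj).ne this
      refine le_trans ?_ h2
      rw [Finset.prod_const, ← Real.exp_nat_mul]
      apply Real.exp_le_exp.mpr
      have h3 : ((Finset.Ioi i).card : ℝ) ≤ s := by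
        have := Finset.card_le_univ (Finset.Ioi i)
        rw [Fintype.card_fin] at this
        exact_mod_cast this
      nlinarith
    calc Real.exp (-(s ^ 2 * Z)) = ∏ _i : Fin s, Real.exp (-(s * Z)) := by
          rw [Finset.prod_const, ← Real.exp_nat_mul, Finset.card_univ, Fintype.card_fin]
          congr 1
          ring
      _ ≤ _ := Finset.prod_le_prod (fun _ _ ↦ (Real.exp_pos _).le) fun i _ ↦ h1 i
  have hLF := zero_lt_one.trans_le (one_le_polyLength hF0)
  have hLG := zero_lt_one.trans_le (one_le_polyLength hG0)
  have hmn : (0 : ℝ) < (m + n : ℕ) := by exact_mod_cast hpos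
  have hfac : ∀ i ∈ A, (m + n : ℕ) * Real.exp ρ ^ (m + n) * v i ≠ 0 := fun i hi ↦ by
    have := hv i hi
    positivity
  have hprod : ∏ i ∈ A, ((m + n : ℕ) * Real.exp ρ ^ (m + n) * v i) ≠ 0 :=
    Finset.prod_ne_zero_iff.mpr hfac
  have hlog := Real.log_le_log (Real.exp_pos _) (hlow.trans key)
  rw [Real.log_exp, Real.log_mul (by positivity) hprod, Real.log_mul (by positivity)
    (by positivity), Real.log_mul (by positivity) (by positivity), Real.log_pow, Real.log_pow,
    Real.log_pow, Real.log_prod hfac] at hlog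
  have hterm : ∀ i ∈ A, Real.log ((m + n : ℕ) * Real.exp ρ ^ (m + n) * v i) ≤
      (m + n) * (1 + ρ) - -Real.log (v i) := by
    intro i hi
    rw [Real.log_mul (by positivity) (hv i hi).ne', Real.log_mul (by positivity) (by positivity),
      Real.log_pow, Real.log_exp]
    have := (Real.log_le_sub_one_of_pos hmn)
    push_cast at this ⊢
    linarith
  have hsum := Finset.sum_le_sum hterm
  rw [Finset.sum_sub_distrib, Finset.sum_const, nsmul_eq_mul] at hsum
  have hlog2 : Real.log 2 ≤ 1 := by
    have := Real.log_two_lt_d9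
    linarith
  have h5 : ((m + n : ℕ) : ℝ) * Real.log 2 ≤ (m + n : ℕ) * 1 := by gcongr
  rw [← hs] at hsum
  push_cast at h5 hlog hsum
  linarith

/-- The case of one point of `sum_neg_log_le_of_no_common_root`. -/
lemma neg_log_le_of_no_common_root {F G : ℤ[X]} (hF0 : F ≠ 0) (hG0 : G ≠ 0)
    (h : ∀ z : ℂ, aeval z F = 0 → aeval z G ≠ 0) (hpos : 0 < F.natDegree + G.natDegree)
    {x : ℂ} {v ρ : ℝ} (hv : 0 < v) (hFv : ‖aeval x F‖ ≤ v) (hGv : ‖aeval x G‖ ≤ v)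
    (hρ : 0 ≤ ρ) (hx : ‖x‖ ≤ Real.exp ρ) :
    -Real.log v ≤ G.natDegree * Real.log (polyLength F) + F.natDegree * Real.log (polyLength G) +
      (F.natDegree + G.natDegree) * (2 + ρ) := by
  have := sum_neg_log_le_of_no_common_root hF0 hG0 h le_rfl ({()} : Finset Unit)
    (by rw [Finset.card_singleton]; exact hpos) hpos (fun _ ↦ x) (fun _ ↦ v)
    (by simpa using hv) (by simpa using hFv) (by simpa using hGv) hρ (by simpa using hx) (Z := 0) le_rfl
    (by simp)
  simp only [Finset.sum_singleton, Finset.card_singleton, Nat.cast_one] at this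
  linarith

/-- A nonnegative matrix whose columns overlap little has most of its mass in the maximal entries
of its rows. -/
lemma exists_sum_le_sum_add_sum_min {ι κ : Type*} [DecidableEq κ] (A : Finset ι) {B : Finset κ}
    (hB : B.Nonempty) (f : ι → κ → ℝ) (hf : ∀ a b, 0 ≤ f a b) :
    ∃ g : ι → κ, (∀ a, g a ∈ B) ∧ ∑ a ∈ A, ∑ b ∈ B, f a b ≤ ∑ a ∈ A, f a (g a) +
      ∑ b ∈ B, ∑ b' ∈ B.erase b, ∑ a ∈ A, min (f a b) (f a b') := by
  choose g hg hmax using fun a ↦ B.exists_max_image (f a) hB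
  refine ⟨g, hg, ?_⟩
  have h1 : ∑ b ∈ B, ∑ b' ∈ B.erase b, ∑ a ∈ A, min (f a b) (f a b') =
      ∑ a ∈ A, ∑ b ∈ B, ∑ b' ∈ B.erase b, min (f a b) (f a b') := by
    rw [Finset.sum_comm (s := A)]
    refine Finset.sum_congr rfl fun b _ ↦ Finset.sum_comm
  rw [h1, ← Finset.sum_add_distrib]
  refine Finset.sum_le_sum fun a _ ↦ ?_
  rw [← Finset.add_sum_erase B (f a) (hg a)]
  gcongr
  calc ∑ b ∈ B.erase (g a), f a b ≤
        ∑ b ∈ B.erase (g a), ∑ b' ∈ B.erase b, min (f a b) (f a b') := by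
        refine Finset.sum_le_sum fun b hb ↦ ?_
        rw [Finset.mem_erase] at hb
        have h2 : min (f a b) (f a (g a)) = f a b := min_eq_left (hmax a b hb.2)
        rw [← h2]
        conv_rhs => rw [h2]
        exact Finset.single_le_sum (f := fun b' ↦ min (f a b) (f a b'))
          (fun b' _ ↦ le_min (hf a b) (hf a b')) (Finset.mem_erase.mpr ⟨hb.1.symm, hg a⟩)
    _ ≤ _ := Finset.sum_le_sum_of_subset_of_nonneg (Finset.erase_subset _ _)
        fun b _ _ ↦ Finset.sum_nonneg fun b' _ ↦ le_min (hf a b) (hf a b')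

lemma log_polyLength_X_pow_sub_one_le (k : ℕ) (hk : 0 < k) :
    Real.log (polyLength (X ^ k - 1 : ℤ[X])) ≤ 1 := by
  have h0 : (X ^ k - 1 : ℤ[X]) ≠ 0 := X_pow_sub_C_ne_zero hk 1
  have h1 : polyLength (X ^ k - 1 : ℤ[X]) ≤ 2 := by
    have hs : (X ^ k - 1 : ℤ[X]).support ⊆ {0, k} := by
      intro j hj
      rw [mem_support_iff, coeff_sub, coeff_X_pow, coeff_one] at hj
      by_contra h
      simp only [Finset.mem_insert, Finset.mem_singleton, not_or] at h
      simp [h.1, h.2] at hj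
    refine (Finset.sum_le_sum_of_subset_of_nonneg hs fun _ _ _ ↦ norm_nonneg _).trans ?_
    rw [Finset.sum_pair hk.ne]
    simp [coeff_one, coeff_X_pow, hk.ne', hk.ne]
    norm_num
  have h2 := Real.log_le_log (zero_lt_one.trans_le (one_le_polyLength h0)) h1
  have := Real.log_two_lt_d9
  linarith

/-! ### Concentration of small values -/

lemma natDegree_expand_le {Q : ℤ[X]} {D T : ℝ} (hD : (Q.natDegree : ℝ) ≤ D) {a : ℕ}
    (ha : (a : ℝ) ≤ T) : ((expand ℤ a Q).natDegree : ℝ) ≤ D * T := by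
  rw [natDegree_expand]
  push_cast
  exact mul_le_mul hD ha (Nat.cast_nonneg _) ((Nat.cast_nonneg _).trans hD)

lemma log_polyLength_expand_le {Q : ℤ[X]} (hQ : Q ≠ 0) {a : ℕ} (ha : 0 < a) {H : ℝ}
    (hH : Real.log (polyLength Q) ≤ H) : Real.log (polyLength (expand ℤ a Q)) ≤ H :=
  (Real.log_le_log (zero_lt_one.trans_le (one_le_polyLength ((expand_ne_zero ha).mpr hQ)))
    (polyLength_expand_le Q ha)).trans hH

lemma aeval_ne_zero_of_transcendental {ξ : ℂ} (hξ : Transcendental ℚ ξ) {P : ℤ[X]} (hP : P ≠ 0) :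
    aeval ξ P ≠ 0 := by
  intro h
  refine hξ ⟨P.map (Int.castRingHom ℚ),
    (Polynomial.map_ne_zero_iff (RingHom.injective_int _)).mpr hP, ?_⟩
  rwa [← algebraMap_int_eq, aeval_map_algebraMap]

lemma aeval_pow_ne_zero_of_transcendental {ξ : ℂ} (hξ : Transcendental ℚ ξ) {Q : ℤ[X]} (hQ : Q ≠ 0)
    {q : ℕ} (hq : 0 < q) : aeval (ξ ^ q) Q ≠ 0 := by
  rw [← expand_aeval]
  exact aeval_ne_zero_of_transcendental hξ ((expand_ne_zero hq).mpr hQ)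

/-- If `Q` takes a very small value at some `ξ ^ q`, then `ξ` is not too close to a root of unity
of small order: compare `Q (T ^ q)` with `T ^ k - 1`. -/
lemma exp_neg_le_norm_pow_sub_one {ξ : ℂ} {ρ : ℝ} (hρ : 0 ≤ ρ) (hξ : ‖ξ‖ ≤ Real.exp ρ)
    {Q : ℤ[X]} (hQ : Q ≠ 0) (ht : NoTorsionOrZeroRoot Q) {D h M : ℝ} (hD : 1 ≤ D) (hM : 1 ≤ M)
    (hDMh : D * M ^ 2 ≤ h) (hdeg : (Q.natDegree : ℝ) ≤ D)
    (hlen : Real.log (polyLength Q) ≤ 2 * h) {q : ℕ} (hq : 0 < q) (hqM : (q : ℝ) ≤ M ^ 2)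
    (hsmall : ‖aeval (ξ ^ q) Q‖ < Real.exp (-((7 + 2 * ρ) * (M * h)))) {k : ℕ} (hk : 0 < k)
    (hkM : (k : ℝ) ≤ M) :
    Real.exp (-((7 + 2 * ρ) * (M * h))) ≤ ‖ξ ^ k - 1‖ := by
  by_contra! hlt
  set v := max ‖aeval (ξ ^ q) Q‖ ‖ξ ^ k - 1‖ with hv
  have hvlt : v < Real.exp (-((7 + 2 * ρ) * (M * h))) := max_lt hsmall hlt
  have hF0 : (X ^ k - 1 : ℤ[X]) ≠ 0 := X_pow_sub_C_ne_zero hk 1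
  have hG0 : expand ℤ q Q ≠ 0 := (expand_ne_zero hq).mpr hQ
  have hno : ∀ z : ℂ, aeval z (X ^ k - 1 : ℤ[X]) = 0 → aeval z (expand ℤ q Q) ≠ 0 := by
    intro z hz
    simp only [map_sub, map_pow, aeval_X, map_one, sub_eq_zero] at hz
    rw [expand_aeval]
    exact ht _ (Or.inr ⟨k, hk, by rw [← pow_mul, mul_comm, pow_mul, hz, one_pow]⟩)
  have hFd : (X ^ k - 1 : ℤ[X]).natDegree = k := natDegree_X_pow_sub_C
  -- a slightly larger value, to be sure that it is positive
  obtain ⟨w, hw1, hw2⟩ := exists_between hvlt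
  have hwpos : 0 < w := ((norm_nonneg _).trans (le_max_left _ _)).trans_lt hw1
  have key := neg_log_le_of_no_common_root hF0 hG0 hno (by omega) hwpos (x := ξ)
    (by simpa using (le_max_right _ _).trans hw1.le)
    (by rw [expand_aeval]; exact (le_max_left _ _).trans hw1.le) hρ hξ
  rw [hFd] at key
  have h1 := log_polyLength_X_pow_sub_one_le k hk
  have h2 := log_polyLength_expand_le hQ hq hlen
  have h3 := (natDegree_expand_le hdeg hqM).trans hDMh
  have h4 : (7 + 2 * ρ) * (M * h) < -Real.log w := by
    have := Real.log_lt_log hwpos hw2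
    rw [Real.log_exp] at this
    linarith
  have hh : 1 ≤ h := le_trans (one_le_mul_of_one_le_of_one_le hD (one_le_pow₀ hM)) hDMh
  have h5 : ((expand ℤ q Q).natDegree : ℝ) * Real.log (polyLength (X ^ k - 1 : ℤ[X])) ≤ h * 1 :=
    mul_le_mul h3 h1 (Real.log_nonneg (one_le_polyLength hF0)) (by linarith)
  have h6 : (k : ℝ) * Real.log (polyLength (expand ℤ q Q)) ≤ M * (2 * h) :=
    mul_le_mul hkM h2 (Real.log_nonneg (one_le_polyLength hG0)) (by linarith)
  have hMh1 : h ≤ M * h := by nlinarith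
  have hMh2 : M ≤ M * h := by nlinarith
  have h7 : ((k : ℝ) + (expand ℤ q Q).natDegree) * (2 + ρ) ≤ (2 * (M * h)) * (2 + ρ) := by
    gcongr
    linarith
  nlinarith

/-- Different powers of `ξ` with small exponents are not too close. -/
lemma exp_neg_le_norm_pow_sub_pow {ξ : ℂ} {ρ : ℝ} (hξ' : Real.exp (-ρ) ≤ ‖ξ‖)
    (hρ : 0 ≤ ρ) {M E : ℝ} (hsep : ∀ k : ℕ, 0 < k → (k : ℝ) ≤ M → Real.exp (-E) ≤ ‖ξ ^ k - 1‖)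
    {i j : ℕ} (hi : (i : ℝ) ≤ M) (hj : (j : ℝ) ≤ M) (hij : i ≠ j) :
    Real.exp (-(M * ρ + E)) ≤ ‖ξ ^ j - ξ ^ i‖ := by
  wlog hlt : i < j generalizing i j
  · rw [norm_sub_rev]
    exact this hj hi hij.symm (by omega)
  obtain ⟨k, rfl⟩ := Nat.exists_eq_add_of_le hlt.le
  have h1 : ξ ^ (i + k) - ξ ^ i = ξ ^ i * (ξ ^ k - 1) := by ring
  rw [h1, norm_mul, norm_pow, neg_add, Real.exp_add]
  have hk : (k : ℝ) ≤ M := by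
    push_cast at hj
    linarith [(Nat.cast_nonneg i : (0 : ℝ) ≤ i)]
  refine mul_le_mul ?_ (hsep k (by omega) hk) (Real.exp_pos _).le (by positivity)
  calc Real.exp (-(M * ρ)) ≤ Real.exp (-ρ) ^ i := by
        rw [← Real.exp_nat_mul]
        apply Real.exp_le_exp.mpr
        nlinarith
    _ ≤ ‖ξ‖ ^ i := by gcongr

/-- The values of `Q (T ^ b)` and `Q (T ^ b')` at the powers `ξ ^ a`, for `b ≠ b'`, cannot be
simultaneously very small, in the sense that the sum over `a` of the minimum of the two sizes is
bounded. -/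
lemma sum_min_neg_log_le {ξ : ℂ} {ρ : ℝ} (hρ : 0 ≤ ρ)
    (hξ1 : ‖ξ‖ ≤ Real.exp ρ) {Q : ℤ[X]} (hprim : IsPrimaryPoly Q) (ht : NoTorsionOrZeroRoot Q)
    (hd : Q.natDegree ≠ 0) {D h M Z : ℝ} (hD : 1 ≤ D) (hM : 1 ≤ M)
    (hDMh : D * M ^ 2 ≤ h) (hdeg : (Q.natDegree : ℝ) ≤ D)
    (hlen : Real.log (polyLength Q) ≤ 2 * h) {A : Finset ℕ} (hA : ∀ a ∈ A, (a : ℝ) ≤ M)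
    (hcard : (A.card : ℝ) ≤ M) (hZ : 0 ≤ Z)
    (hsep : ∀ i ∈ A, ∀ j ∈ A, i ≠ j → Real.exp (-Z) ≤ ‖ξ ^ j - ξ ^ i‖)
    {b b' : ℕ} (hb : 0 < b) (hbM : (b : ℝ) ≤ M) (hb' : 0 < b') (hbM' : (b' : ℝ) ≤ M)
    (hbb : b ≠ b') :
    ∑ a ∈ A, min (max 0 (-Real.log ‖aeval (ξ ^ (a * b)) Q‖))
        (max 0 (-Real.log ‖aeval (ξ ^ (a * b')) Q‖)) ≤
      (12 + 3 * ρ) * (D * M * h) + M ^ 2 * Z := by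
  have hQ : Q ≠ 0 := by rintro rfl; simp at hd
  set u : ℕ → ℝ := fun a ↦ ‖aeval (ξ ^ (a * b)) Q‖ with hu
  set w : ℕ → ℝ := fun a ↦ ‖aeval (ξ ^ (a * b')) Q‖ with hw
  set t : ℕ → ℝ := fun a ↦ min (max 0 (-Real.log (u a))) (max 0 (-Real.log (w a))) with ht'
  -- points with vanishing term are dropped: one of the values is at least `1` there, or it is `0`,
  -- in which case the convention `log 0 = 0` applies
  set A' := A.filter (fun a ↦ t a ≠ 0) with hA'
  have hsub : A' ⊆ A := Finset.filter_subset _ _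
  have hcard' : (A'.card : ℝ) ≤ M :=
    le_trans (by exact_mod_cast Finset.card_le_card hsub) hcard
  set F := expand ℤ b Q with hF
  set G := expand ℤ b' Q with hG
  have hF0 : F ≠ 0 := (expand_ne_zero hb).mpr hQ
  have hG0 : G ≠ 0 := (expand_ne_zero hb').mpr hQ
  have hFd : (F.natDegree : ℝ) ≤ D * M := natDegree_expand_le hdeg hbM
  have hGd : (G.natDegree : ℝ) ≤ D * M := natDegree_expand_le hdeg hbM'
  have hFl : Real.log (polyLength F) ≤ 2 * h := log_polyLength_expand_le hQ hb hlen
  have hGl : Real.log (polyLength G) ≤ 2 * h := log_polyLength_expand_le hQ hb' hlen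
  have hFa : ∀ a, aeval (ξ ^ a) F = aeval (ξ ^ (a * b)) Q := fun a ↦ by
    rw [hF, expand_aeval, ← pow_mul]
  have hGa : ∀ a, aeval (ξ ^ a) G = aeval (ξ ^ (a * b')) Q := fun a ↦ by
    rw [hG, expand_aeval, ← pow_mul]
  have hmem : ∀ a ∈ A', 0 < max (u a) (w a) ∧ t a = -Real.log (max (u a) (w a)) := by
    intro a ha
    have hta : t a ≠ 0 := (Finset.mem_filter.mp ha).2
    have htpos : 0 < t a := lt_of_le_of_ne (le_min (le_max_left _ _) (le_max_left _ _)) hta.symm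
    have h1 : 0 < -Real.log (u a) := by
      have := htpos.trans_le (min_le_left _ _)
      simpa using this
    have h2 : 0 < -Real.log (w a) := by
      have := htpos.trans_le (min_le_right _ _)
      simpa using this
    have hu0 : 0 < u a := lt_of_le_of_ne (norm_nonneg _) fun h0 ↦ by
      rw [← h0, Real.log_zero] at h1
      simp at h1
    have hw0 : 0 < w a := lt_of_le_of_ne (norm_nonneg _) fun h0 ↦ by
      rw [← h0, Real.log_zero] at h2
      simp at h2
    refine ⟨lt_max_of_lt_left hu0, ?_⟩
    simp only [ht', max_eq_right h1.le, max_eq_right h2.le]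
    rcases le_total (u a) (w a) with hle | hle
    · rw [max_eq_right hle, min_eq_right (neg_le_neg (Real.log_le_log hu0 hle))]
    · rw [max_eq_left hle, min_eq_left (neg_le_neg (Real.log_le_log hw0 hle))]
  have hGpos : 0 < G.natDegree := by
    rw [hG, natDegree_expand]
    exact Nat.mul_pos (Nat.pos_of_ne_zero hd) hb'
  -- the formal degree of `F` is raised by the number of points, which may exceed the degrees
  have key := sum_neg_log_le_of_no_common_root hF0 hG0
    (fun z hz ↦ by
      rw [hF, expand_aeval] at hz
      rw [hG, expand_aeval]
      exact aeval_pow_ne_zero_of_aeval_pow_eq_zero hprim ht hd hb hbb hz)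
    (m := F.natDegree + A'.card) (Nat.le_add_right _ _) A' (by omega) (by omega)
    (fun a ↦ ξ ^ a) (fun a ↦ max (u a) (w a)) (fun a ha ↦ (hmem a ha).1)
    (fun a _ ↦ by rw [hFa]; exact le_max_left _ _) (fun a _ ↦ by rw [hGa]; exact le_max_right _ _)
    (ρ := M * ρ) (Z := Z) (by positivity)
    (fun a ha ↦ by
      rw [norm_pow]
      refine (pow_le_pow_left₀ (norm_nonneg _) hξ1 a).trans ?_
      rw [← Real.exp_nat_mul]
      exact Real.exp_le_exp.mpr (mul_le_mul_of_nonneg_right (hA a (hsub ha)) hρ))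
    hZ (fun i hi j hj ↦ hsep i (hsub hi) j (hsub hj))
  have hsum : ∑ a ∈ A, t a = ∑ a ∈ A', -Real.log (max (u a) (w a)) := by
    rw [← Finset.sum_filter_of_ne (p := fun a ↦ t a ≠ 0) (fun _ _ h ↦ h)]
    exact Finset.sum_congr rfl fun a ha ↦ (hmem a ha).2
  rw [hsum]
  refine key.trans ?_
  have hD0 : 0 < D := by linarith
  have hM0 : 0 < M := by linarith
  have hh : 1 ≤ h := le_trans (one_le_mul_of_one_le_of_one_le hD (one_le_pow₀ hM)) hDMh
  have hDM : M ≤ D * M := by nlinarith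
  have hm : ((F.natDegree + A'.card : ℕ) : ℝ) ≤ 2 * (D * M) := by
    push_cast
    linarith
  have hmn : ((F.natDegree + A'.card : ℕ) : ℝ) + G.natDegree ≤ 3 * (D * M) := by linarith
  have e1 : (G.natDegree : ℝ) * Real.log (polyLength F) ≤ D * M * (2 * h) :=
    mul_le_mul hGd hFl (Real.log_nonneg (one_le_polyLength hF0)) (by positivity)
  have e2 : ((F.natDegree + A'.card : ℕ) : ℝ) * Real.log (polyLength G) ≤
      2 * (D * M) * (2 * h) :=
    mul_le_mul hm hGl (Real.log_nonneg (one_le_polyLength hG0)) (by positivity)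
  have e3 : (A'.card : ℝ) * ((((F.natDegree + A'.card : ℕ) : ℝ) + G.natDegree) * (1 + M * ρ)) ≤
      M * (3 * (D * M) * (1 + M * ρ)) := by
    gcongr
  have e4 : (A'.card : ℝ) ^ 2 * Z ≤ M ^ 2 * Z := by gcongr
  have e5 : D * M ≤ D * M * h := le_mul_of_one_le_right (by positivity) hh
  have e6 : h ≤ D * M * h := le_mul_of_one_le_left (by linarith) (by nlinarith)
  have e7 : (D * M ^ 2) * (M * ρ) ≤ h * (M * ρ) := by gcongr
  have e8 : h * (M * ρ) ≤ D * (h * (M * ρ)) := le_mul_of_one_le_left (by positivity) hD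
  nlinarith

/-- **Concentration.** If the product of the values `Q (ξ ^ (a * b))` is very small, then one of
the values alone carries, up to a factor `2`, the share of an average row. -/
theorem exists_le_neg_log_of_prod_le {ξ : ℂ} (hξ : Transcendental ℚ ξ) {ρ : ℝ} (hρ : 0 ≤ ρ)
    (hξ1 : ‖ξ‖ ≤ Real.exp ρ) (hξ2 : Real.exp (-ρ) ≤ ‖ξ‖)
    {Q : ℤ[X]} (hprim : IsPrimaryPoly Q) (ht : NoTorsionOrZeroRoot Q)
    (hd : Q.natDegree ≠ 0) {D h M L : ℝ} (hD : 1 ≤ D) (hM : 1 ≤ M) (hMD : M ^ 2 ≤ D)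
    (hDMh : D * M ^ 2 ≤ h) (hdeg : (Q.natDegree : ℝ) ≤ D)
    (hlen : Real.log (polyLength Q) ≤ 2 * h) {A B : Finset ℕ} (hAne : A.Nonempty)
    (hBne : B.Nonempty) (hA : ∀ a ∈ A, 0 < a ∧ (a : ℝ) ≤ M) (hB : ∀ b ∈ B, 0 < b ∧ (b : ℝ) ≤ M)
    (hAc : (A.card : ℝ) ≤ M) (hBc : (B.card : ℝ) ≤ M)
    (hL : 2 * (19 + 6 * ρ) * (D * M ^ 3 * h) ≤ L)
    (hprod : ∏ a ∈ A, ∏ b ∈ B, ‖aeval (ξ ^ (a * b)) Q‖ ≤ Real.exp (-L)) :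
    ∃ a ∈ A, ∃ b ∈ B, L / (2 * M) ≤ -Real.log ‖aeval (ξ ^ (a * b)) Q‖ := by
  have hQ : Q ≠ 0 := by rintro rfl; simp at hd
  have hD0 : 0 < D := by linarith
  have hM0 : 0 < M := by linarith
  have hh : 1 ≤ h := le_trans (one_le_mul_of_one_le_of_one_le hD (one_le_pow₀ hM)) hDMh
  have hh0 : 0 < h := by linarith
  have hL0 : 0 < L := lt_of_lt_of_le (by positivity) hL
  have hval : ∀ a ∈ A, ∀ b ∈ B, ‖aeval (ξ ^ (a * b)) Q‖ ≠ 0 := fun a ha b hb ↦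
    norm_ne_zero_iff.mpr (aeval_pow_ne_zero_of_transcendental hξ hQ
      (Nat.mul_pos (hA a ha).1 (hB b hb).1))
  set f : ℕ → ℕ → ℝ := fun a b ↦ max 0 (-Real.log ‖aeval (ξ ^ (a * b)) Q‖) with hf
  have hf0 : ∀ a b, 0 ≤ f a b := fun a b ↦ le_max_left _ _
  have hLf : L ≤ ∑ a ∈ A, ∑ b ∈ B, f a b := by
    have h1 : 0 < ∏ a ∈ A, ∏ b ∈ B, ‖aeval (ξ ^ (a * b)) Q‖ :=
      Finset.prod_pos fun a ha ↦ Finset.prod_pos fun b hb ↦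
        lt_of_le_of_ne (norm_nonneg _) (hval a ha b hb).symm
    have h2 := Real.log_le_log h1 hprod
    rw [Real.log_exp, Real.log_prod fun a ha ↦ Finset.prod_ne_zero_iff.mpr (hval a ha)] at h2
    calc L ≤ -∑ a ∈ A, Real.log (∏ b ∈ B, ‖aeval (ξ ^ (a * b)) Q‖) := by linarith
      _ = ∑ a ∈ A, ∑ b ∈ B, -Real.log ‖aeval (ξ ^ (a * b)) Q‖ := by
          rw [← Finset.sum_neg_distrib]
          refine Finset.sum_congr rfl fun a ha ↦ ?_
          rw [Real.log_prod (hval a ha), Finset.sum_neg_distrib]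
      _ ≤ _ := Finset.sum_le_sum fun a _ ↦ Finset.sum_le_sum fun b _ ↦ le_max_right _ _
  -- some value is small enough to keep `ξ` away from the roots of unity
  obtain ⟨a₀, ha₀, b₀, hb₀, h₀⟩ : ∃ a ∈ A, ∃ b ∈ B,
      ‖aeval (ξ ^ (a * b)) Q‖ < Real.exp (-((7 + 2 * ρ) * (M * h))) := by
    by_contra! hcon
    have h1 : ∑ a ∈ A, ∑ b ∈ B, f a b ≤ M * (M * ((7 + 2 * ρ) * (M * h))) := by
      have h2 : ∀ a ∈ A, ∑ b ∈ B, f a b ≤ M * ((7 + 2 * ρ) * (M * h)) := by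
        intro a ha
        refine (Finset.sum_le_card_nsmul _ _ ((7 + 2 * ρ) * (M * h)) fun b hb ↦ ?_).trans ?_
        · refine max_le (by positivity) ?_
          have := Real.log_le_log (Real.exp_pos _) (hcon a ha b hb)
          rw [Real.log_exp] at this
          linarith
        · rw [nsmul_eq_mul]
          gcongr
      refine (Finset.sum_le_card_nsmul _ _ _ h2).trans ?_
      rw [nsmul_eq_mul]
      gcongr
    have h3 : M ^ 3 * h ≤ D * M ^ 3 * h := by
      rw [mul_assoc]
      exact le_mul_of_one_le_left (by positivity) hD
    have h4 : 0 < M ^ 3 * h := by positivity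
    nlinarith
  have hone (k : ℕ) (hk : 0 < k) (hkM : (k : ℝ) ≤ M) :=
    exp_neg_le_norm_pow_sub_one hρ hξ1 hQ ht hD hM hDMh hdeg hlen
    (Nat.mul_pos (hA a₀ ha₀).1 (hB b₀ hb₀).1)
    (by
      push_cast
      rw [sq]
      exact mul_le_mul (hA a₀ ha₀).2 (hB b₀ hb₀).2 (Nat.cast_nonneg _) hM0.le) h₀ hk hkM
  have hsep : ∀ i ∈ A, ∀ j ∈ A, i ≠ j →
      Real.exp (-(M * ρ + (7 + 2 * ρ) * (M * h))) ≤ ‖ξ ^ j - ξ ^ i‖ := fun i hi j hj hij ↦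
    exp_neg_le_norm_pow_sub_pow hξ2 hρ hone (hA i hi).2 (hA j hj).2 hij
  obtain ⟨g, hg, hsum⟩ := exists_sum_le_sum_add_sum_min A hBne f hf0
  set E := (19 + 6 * ρ) * (D * M * h) with hE
  have hE0 : 0 ≤ E := by positivity
  have hpair : ∀ b ∈ B, ∀ b' ∈ B.erase b, ∑ a ∈ A, min (f a b) (f a b') ≤ E := by
    intro b hb b' hb'
    rw [Finset.mem_erase] at hb'
    have h1 := sum_min_neg_log_le hρ hξ1 hprim ht hd hD hM hDMh hdeg hlen
      (fun a ha ↦ (hA a ha).2) hAc (by positivity) hsep (hB b hb).1 (hB b hb).2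
      (hB b' hb'.2).1 (hB b' hb'.2).2 (Ne.symm hb'.1)
    refine h1.trans ?_
    have h2 : M ^ 2 * (M * ρ + (7 + 2 * ρ) * (M * h)) ≤
        D * (M * ρ * h + (7 + 2 * ρ) * (M * h)) := by
      refine mul_le_mul hMD (add_le_add ?_ le_rfl) (by positivity) hD0.le
      exact le_mul_of_one_le_right (by positivity) hh
    rw [hE]
    nlinarith
  have hdouble : ∑ b ∈ B, ∑ b' ∈ B.erase b, ∑ a ∈ A, min (f a b) (f a b') ≤ M * (M * E) := by
    have h2 : ∀ b ∈ B, ∑ b' ∈ B.erase b, ∑ a ∈ A, min (f a b) (f a b') ≤ M * E := by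
      intro b hb
      refine (Finset.sum_le_card_nsmul _ _ E (hpair b hb)).trans ?_
      rw [nsmul_eq_mul]
      have : ((B.erase b).card : ℝ) ≤ M :=
        le_trans (by exact_mod_cast Finset.card_le_card (Finset.erase_subset _ _)) hBc
      gcongr
    refine (Finset.sum_le_card_nsmul _ _ _ h2).trans ?_
    rw [nsmul_eq_mul]
    gcongr
  have hhalf : M * (M * E) ≤ L / 2 := by
    rw [hE]
    linarith [hL, show M * (M * ((19 + 6 * ρ) * (D * M * h))) =
      (19 + 6 * ρ) * (D * M ^ 3 * h) by ring]
  by_contra! hcon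
  have hlt : ∑ a ∈ A, f a (g a) < A.card • (L / (2 * M)) := by
    rw [← Finset.sum_const]
    refine Finset.sum_lt_sum_of_nonempty hAne fun a ha ↦ ?_
    exact max_lt (by positivity) (hcon a ha (g a) (hg a))
  rw [nsmul_eq_mul] at hlt
  have hle : (A.card : ℝ) * (L / (2 * M)) ≤ M * (L / (2 * M)) := by gcongr
  have heq : M * (L / (2 * M)) = L / 2 := by field_simp
  linarith

/-! ### Mahler measures and Gel'fond's criterion -/

/-- The logarithm of the Mahler measure of an integer polynomial. -/
noncomputable def logMahler (P : ℤ[X]) : ℝ :=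
  Real.log (P.map (Int.castRingHom ℂ)).mahlerMeasure

lemma map_intCast_ne_zero {P : ℤ[X]} (hP : P ≠ 0) : P.map (Int.castRingHom ℂ) ≠ 0 :=
  (Polynomial.map_ne_zero_iff (RingHom.injective_int _)).mpr hP

lemma logMahler_nonneg {P : ℤ[X]} (hP : P ≠ 0) : 0 ≤ logMahler P :=
  Real.log_nonneg (one_le_mahlerMeasure_of_ne_zero hP)

lemma logMahler_mul {P Q : ℤ[X]} (hP : P ≠ 0) (hQ : Q ≠ 0) :
    logMahler (P * Q) = logMahler P + logMahler Q := by
  unfold logMahler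
  rw [Polynomial.map_mul, mahlerMeasure_mul, Real.log_mul
    (mahlerMeasure_pos_of_ne_zero (map_intCast_ne_zero hP)).ne'
    (mahlerMeasure_pos_of_ne_zero (map_intCast_ne_zero hQ)).ne']

lemma logMahler_le_of_dvd {P Q : ℤ[X]} (hQ : Q ≠ 0) (h : P ∣ Q) : logMahler P ≤ logMahler Q := by
  obtain ⟨R, rfl⟩ := h
  rw [logMahler_mul (left_ne_zero_of_mul hQ) (right_ne_zero_of_mul hQ)]
  linarith [logMahler_nonneg (right_ne_zero_of_mul hQ)]

lemma logMahler_le_log_polyLength {P : ℤ[X]} (hP : P ≠ 0) :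
    logMahler P ≤ Real.log (polyLength P) := by
  refine Real.log_le_log (mahlerMeasure_pos_of_ne_zero (map_intCast_ne_zero hP)) ?_
  refine (mahlerMeasure_le_sum_norm_coeff _).trans (le_of_eq ?_)
  rw [Polynomial.sum, support_map_of_injective _ (RingHom.injective_int _)]
  simp [polyLength, Int.norm_eq_abs]

lemma log_polyLength_le {P : ℤ[X]} (hP : P ≠ 0) :
    Real.log (polyLength P) ≤ P.natDegree + logMahler P := by
  have hM := mahlerMeasure_pos_of_ne_zero (map_intCast_ne_zero hP)
  have h1 : polyLength P ≤ 2 ^ P.natDegree * (P.map (Int.castRingHom ℂ)).mahlerMeasure := by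
    have h2 : ∀ k, ‖P.coeff k‖ ≤
        (P.natDegree.choose k : ℝ) * (P.map (Int.castRingHom ℂ)).mahlerMeasure := by
      intro k
      have := norm_coeff_le_choose_mul_mahlerMeasure k (P.map (Int.castRingHom ℂ))
      rw [natDegree_map_eq_of_injective (RingHom.injective_int _)] at this
      simpa [Int.norm_eq_abs] using this
    calc polyLength P ≤ ∑ k ∈ Finset.range (P.natDegree + 1), ‖P.coeff k‖ :=
          Finset.sum_le_sum_of_subset_of_nonneg supp_subset_range_natDegree_succ
            fun _ _ _ ↦ norm_nonneg _
      _ ≤ _ := Finset.sum_le_sum fun k _ ↦ h2 k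
      _ = _ := by
          rw [← Finset.sum_mul]
          congr 1
          exact_mod_cast Nat.sum_range_choose P.natDegree
  refine (Real.log_le_log (zero_lt_one.trans_le (one_le_polyLength hP)) h1).trans ?_
  rw [Real.log_mul (by positivity) hM.ne', Real.log_pow]
  have := Real.log_two_lt_d9
  have h3 : (P.natDegree : ℝ) * Real.log 2 ≤ P.natDegree * 1 := by
    gcongr
    linarith
  unfold logMahler
  linarith

/-- A polynomial with a value small compared with the weight `deg · η + logMahler · δ` has an
irreducible factor with the same property, because weight and logarithmic size are additive. -/
lemma exists_irreducible_factor {ξ : ℂ} (hξ : Transcendental ℚ ξ) {δ η K : ℝ} {P : ℤ[X]}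
    (hP : P ≠ 0) (h : Real.log ‖aeval ξ P‖ < -(K * (P.natDegree * η + logMahler P * δ))) :
    ∃ S : ℤ[X], Irreducible S ∧ S ∣ P ∧
      Real.log ‖aeval ξ S‖ < -(K * (S.natDegree * η + logMahler S * δ)) := by
  induction P using WfDvdMonoid.induction_on_irreducible with
  | zero => exact absurd rfl hP
  | unit u hu =>
    exfalso
    obtain ⟨c, hc, rfl⟩ := Polynomial.isUnit_iff.mp hu
    have hm : logMahler (C c) = Real.log ‖(c : ℂ)‖ := by
      rw [logMahler, Polynomial.map_C, mahlerMeasure_const]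
      rfl
    rw [hm] at h
    rcases Int.isUnit_iff.mp hc with rfl | rfl <;> simp at h
  | mul P S hP0 hS ih =>
    rw [map_mul, norm_mul, natDegree_mul hS.ne_zero hP0, logMahler_mul hS.ne_zero hP0,
      Real.log_mul (norm_ne_zero_iff.mpr (aeval_ne_zero_of_transcendental hξ hS.ne_zero))
        (norm_ne_zero_iff.mpr (aeval_ne_zero_of_transcendental hξ hP0))] at h
    push_cast at h
    by_cases h1 : Real.log ‖aeval ξ S‖ < -(K * (S.natDegree * η + logMahler S * δ))
    · exact ⟨S, hS, dvd_mul_right _ _, h1⟩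
    · obtain ⟨T, hT, hdvd, h2⟩ := ih hP0 (by linarith)
      exact ⟨T, hT, hdvd.mul_left _, h2⟩

/-- Two irreducible integer polynomials that are both very small at `ξ` are associated. -/
lemma associated_of_small {ξ : ℂ} (hξ : Transcendental ℚ ξ) {ρ : ℝ} (hρ : 0 ≤ ρ)
    (hξ1 : ‖ξ‖ ≤ Real.exp ρ) {δ η : ℝ} (hδη : δ ≤ η) {S T : ℤ[X]} (hS : Irreducible S)
    (hT : Irreducible T) (hSd : S.natDegree ≠ 0) (hTd : T.natDegree ≠ 0)
    (hSδ : (S.natDegree : ℝ) ≤ δ) (hTδ : (T.natDegree : ℝ) ≤ δ) (hSη : logMahler S ≤ 2 * η)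
    (hTη : logMahler T ≤ 2 * η)
    (hSs : Real.log ‖aeval ξ S‖ < -((8 + 2 * ρ) * (S.natDegree * η + logMahler S * δ)))
    (hTs : Real.log ‖aeval ξ T‖ < -((8 + 2 * ρ) * (T.natDegree * η + logMahler T * δ))) :
    Associated S T := by
  by_contra hna
  wlog hle : ‖aeval ξ T‖ ≤ ‖aeval ξ S‖ generalizing S T
  · exact this hT hS hTd hSd hTδ hSδ hTη hSη hTs hSs (fun h ↦ hna h.symm) (not_le.mp hle).le
  have key := neg_log_le_of_no_common_root hS.ne_zero hT.ne_zero
    (fun z hzS hzT ↦ hna (associated_of_common_root hS hT hSd hTd hzS hzT)) (by omega)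
    (norm_pos_iff.mpr (aeval_ne_zero_of_transcendental hξ hS.ne_zero)) le_rfl hle hρ hξ1
  have hs : (1 : ℝ) ≤ S.natDegree := by exact_mod_cast Nat.pos_of_ne_zero hSd
  have ht : (1 : ℝ) ≤ T.natDegree := by exact_mod_cast Nat.pos_of_ne_zero hTd
  have hlS := log_polyLength_le hS.ne_zero
  have hlT := log_polyLength_le hT.ne_zero
  have hmS := logMahler_nonneg hS.ne_zero
  have hmT := logMahler_nonneg hT.ne_zero
  set s : ℝ := (S.natDegree : ℝ)
  set t : ℝ := (T.natDegree : ℝ)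
  set p := logMahler S
  set q := logMahler T
  have h1 : t * Real.log (polyLength S) ≤ t * (s + p) := by gcongr
  have h2 : s * Real.log (polyLength T) ≤ s * (t + q) := by gcongr
  have h3 : t * p ≤ δ * p := by gcongr
  have h4 : s * q ≤ s * (2 * η) := by gcongr
  have h5 : s * t ≤ s * η := by gcongr; linarith
  have h6 : s + t ≤ 2 * (s * η) := by nlinarith
  have h7 : (s + t) * (2 + ρ) ≤ 2 * (s * η) * (2 + ρ) := by gcongr
  have h8 : 0 ≤ p * δ := mul_nonneg hmS (by linarith)
  nlinarith [mul_nonneg hρ h8]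

lemma natDegree_ne_zero_of_small {ξ : ℂ} {δ η K : ℝ} (hδ : 0 ≤ δ) (hK : 0 ≤ K) {S : ℤ[X]}
    (hS : S ≠ 0) (h : Real.log ‖aeval ξ S‖ < -(K * (S.natDegree * η + logMahler S * δ))) :
    S.natDegree ≠ 0 := by
  intro h0
  have h1 := Real.log_nonneg (one_le_norm_aeval_of_natDegree_eq_zero hS h0 ξ)
  have h2 : 0 ≤ K * (S.natDegree * η + logMahler S * δ) := by
    rw [h0, Nat.cast_zero, zero_mul, zero_add]
    exact mul_nonneg hK (mul_nonneg (logMahler_nonneg hS) hδ)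
  linarith

/-- **Gel'fond's criterion.** A transcendental number does not admit, for all large `n`, an
irreducible integer polynomial whose value is small compared with its degree and its Mahler measure,
when the bounds `d n` and `h n` of these grow at most geometrically from one step to the next. -/
theorem false_of_irreducible_sequence {ξ : ℂ} (hξ : Transcendental ℚ ξ) {d h K : ℕ → ℝ} {C : ℝ}
    (hd1 : ∀ n, 1 ≤ d n) (hdh : ∀ n, d n ≤ h n) (hdmono : Monotone d) (hhmono : Monotone h)
    (hdC : ∀ n, d (n + 1) ≤ C * d n) (hhC : ∀ n, h (n + 1) ≤ C * h n)
    (hK : Filter.Tendsto K Filter.atTop Filter.atTop) {S : ℕ → ℤ[X]} {N : ℕ}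
    (hS : ∀ n ≥ N, Irreducible (S n) ∧ ((S n).natDegree : ℝ) ≤ d n ∧ logMahler (S n) ≤ 2 * h n ∧
      Real.log ‖aeval ξ (S n)‖ < -(K n * ((S n).natDegree * h n + logMahler (S n) * d n))) :
    False := by
  obtain ⟨ρ, hρ, hξ1⟩ : ∃ ρ : ℝ, 0 ≤ ρ ∧ ‖ξ‖ ≤ Real.exp ρ :=
    ⟨‖ξ‖, norm_nonneg _, by linarith [Real.add_one_le_exp ‖ξ‖]⟩
  have hC : 1 ≤ C := by
    have h1 := hdmono (Nat.le_succ 0)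
    have h2 := hdC 0
    have h3 := hd1 0
    have h4 : d 0 ≤ C * d 0 := h1.trans h2
    by_contra! hlt
    nlinarith
  obtain ⟨N₁, hN₁⟩ := Filter.eventually_atTop.mp (hK.eventually_ge_atTop (C * (8 + 2 * ρ)))
  set N₂ := max N N₁
  have hdeg : ∀ n ≥ N₂, (S n).natDegree ≠ 0 := by
    intro n hn
    obtain ⟨h1, h2, h3, h4⟩ := hS n (le_trans (le_max_left _ _) hn)
    have h5 := hN₁ n (le_trans (le_max_right _ _) hn)
    exact natDegree_ne_zero_of_small (zero_le_one.trans (hd1 n))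
      (le_trans (by positivity) h5) h1.ne_zero h4
  have hassoc : ∀ n ≥ N₂, Associated (S n) (S (n + 1)) := by
    intro n hn
    obtain ⟨a1, a2, a3, a4⟩ := hS n (le_trans (le_max_left _ _) hn)
    obtain ⟨b1, b2, b3, b4⟩ := hS (n + 1) (le_trans (le_max_left _ _) (Nat.le_succ_of_le hn))
    have a5 := hN₁ n (le_trans (le_max_right _ _) hn)
    have b5 := hN₁ (n + 1) (le_trans (le_max_right _ _) (Nat.le_succ_of_le hn))
    have a6 := logMahler_nonneg a1.ne_zero
    have b6 := logMahler_nonneg b1.ne_zero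
    have hd' := hdmono (Nat.le_succ n)
    have hh' := hhmono (Nat.le_succ n)
    have hd0 := hd1 n
    have hh0 := hdh n
    have hd1' : 0 ≤ d n := zero_le_one.trans hd0
    have hh1' : 0 ≤ h n := hd1'.trans hh0
    refine associated_of_small hξ hρ hξ1 (hdh (n + 1)) a1 b1 (hdeg n hn)
      (hdeg (n + 1) (Nat.le_succ_of_le hn)) (a2.trans hd') b2 (a3.trans (by gcongr)) b3
      (a4.trans_le ?_) (b4.trans_le ?_)
    · rw [neg_le_neg_iff]
      calc (8 + 2 * ρ) * ((S n).natDegree * h (n + 1) + logMahler (S n) * d (n + 1)) ≤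
            (8 + 2 * ρ) * ((S n).natDegree * (C * h n) + logMahler (S n) * (C * d n)) := by
            gcongr
            · exact hhC n
            · exact hdC n
        _ = C * (8 + 2 * ρ) * ((S n).natDegree * h n + logMahler (S n) * d n) := by ring
        _ ≤ _ := by gcongr
    · rw [neg_le_neg_iff]
      have : 8 + 2 * ρ ≤ K (n + 1) := le_trans (le_mul_of_one_le_left (by positivity) hC) b5
      have : 0 ≤ h (n + 1) := by linarith
      have : 0 ≤ d (n + 1) := by linarith
      gcongr
  have hconst : ∀ n ≥ N₂, ‖aeval ξ (S n)‖ = ‖aeval ξ (S N₂)‖ := by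
    intro n hn
    induction n, hn using Nat.le_induction with
    | base => rfl
    | succ n hn ih =>
      rw [← ih]
      obtain ⟨u, hu⟩ := hassoc n hn
      obtain ⟨c, hc, hcu⟩ := Polynomial.isUnit_iff.mp u.isUnit
      rw [← hu, ← hcu, map_mul, norm_mul]
      rcases Int.isUnit_iff.mp hc with rfl | rfl <;> simp
  obtain ⟨N₃, hN₃⟩ := Filter.eventually_atTop.mp
    (hK.eventually_ge_atTop (max 0 (-Real.log ‖aeval ξ (S N₂)‖)))
  set n := max N₂ N₃
  have hn : N₂ ≤ n := le_max_left _ _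
  obtain ⟨a1, a2, a3, a4⟩ := hS n (le_trans (le_max_left _ _) hn)
  have a5 := hN₃ n (le_max_right _ _)
  have a6 := logMahler_nonneg a1.ne_zero
  have hdn : (1 : ℝ) ≤ (S n).natDegree := by exact_mod_cast Nat.pos_of_ne_zero (hdeg n hn)
  have hd0 := hd1 n
  have hh0 := hdh n
  rw [hconst n hn] at a4
  have hw : 1 ≤ (S n).natDegree * h n + logMahler (S n) * d n := by nlinarith
  have hK0 : 0 ≤ K n := (le_max_left _ _).trans a5
  have hK1 : -Real.log ‖aeval ξ (S N₂)‖ ≤ K n := (le_max_right _ _).trans a5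
  nlinarith

/-! ### From small products to irreducible polynomials -/

/-- A very small product of values `Q (ξ ^ (a * b))` yields an irreducible polynomial of controlled
degree and Mahler measure which is very small at `ξ`. -/
lemma exists_irreducible_of_prod_le {ξ : ℂ} (hξ : Transcendental ℚ ξ) {ρ : ℝ} (hρ : 0 ≤ ρ)
    (hξ1 : ‖ξ‖ ≤ Real.exp ρ) (hξ2 : Real.exp (-ρ) ≤ ‖ξ‖)
    {Q : ℤ[X]} (hprim : IsPrimaryPoly Q) (ht : NoTorsionOrZeroRoot Q)
    {D h M L K : ℝ} (hD : 1 ≤ D) (hM : 1 ≤ M) (hMD : M ^ 2 ≤ D)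
    (hDMh : D * M ^ 2 ≤ h) (hdeg : (Q.natDegree : ℝ) ≤ D)
    (hheight : intPolyHeight Q ≤ Real.exp h) {A B : Finset ℕ} (hAne : A.Nonempty)
    (hBne : B.Nonempty) (hA : A ⊆ Finset.Icc 1 ⌊M⌋₊) (hB : B ⊆ Finset.Icc 1 ⌊M⌋₊)
    (hL : 2 * (19 + 6 * ρ) * (D * M ^ 3 * h) ≤ L) (hK : 0 ≤ K)
    (hKL : 6 * K * (D * M ^ 3 * h) < L)
    (hprod : ∏ a ∈ A, ∏ b ∈ B, ‖aeval (ξ ^ (a * b)) Q‖ ≤ Real.exp (-L)) :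
    ∃ S : ℤ[X], Irreducible S ∧ (S.natDegree : ℝ) ≤ D * M ^ 2 ∧ logMahler S ≤ 2 * h ∧
      Real.log ‖aeval ξ S‖ < -(K * (S.natDegree * h + logMahler S * (D * M ^ 2))) := by
  have hD0 : 0 < D := by linarith
  have hM0 : 0 < M := by linarith
  have hh : 1 ≤ h := le_trans (one_le_mul_of_one_le_of_one_le hD (one_le_pow₀ hM)) hDMh
  have hL0 : 0 < L := lt_of_lt_of_le (by positivity) hL
  have hQ : Q ≠ 0 := by
    obtain ⟨R, k, hR, _, rfl⟩ := hprim
    exact pow_ne_zero _ hR.ne_zero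
  -- a constant `Q` would take values of absolute value at least `1`
  have hd : Q.natDegree ≠ 0 := by
    intro hd
    have h1 : (1 : ℝ) ≤ ∏ a ∈ A, ∏ b ∈ B, ‖aeval (ξ ^ (a * b)) Q‖ :=
      one_le_prod_of_one_le _ _ fun a _ ↦ one_le_prod_of_one_le _ _ fun b _ ↦
        one_le_norm_aeval_of_natDegree_eq_zero hQ hd _
    have h2 : Real.exp (-L) < 1 := Real.exp_lt_one_iff.mpr (by linarith)
    linarith
  have hlen : Real.log (polyLength Q) ≤ 2 * h := by
    have h1 : polyLength Q ≤ Real.exp D * Real.exp h := by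
      refine (polyLength_le_of_supNorm Q).trans ?_
      rw [supNorm_eq_intPolyHeight hprim hd]
      have h2 : (Q.natDegree : ℝ) + 1 ≤ Real.exp D := by
        linarith [Real.add_one_le_exp D]
      have h3 : 0 ≤ intPolyHeight Q := by
        rw [← supNorm_eq_intPolyHeight hprim hd]
        exact Q.supNorm_nonneg
      gcongr
    rw [← Real.exp_add] at h1
    have h4 := Real.log_le_log (zero_lt_one.trans_le (one_le_polyLength hQ)) h1
    rw [Real.log_exp] at h4
    have h5 : D ≤ D * M ^ 2 := le_mul_of_one_le_right hD0.le (one_le_pow₀ hM)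
    linarith
  have hmem : ∀ {A : Finset ℕ}, A ⊆ Finset.Icc 1 ⌊M⌋₊ → ∀ a ∈ A, 0 < a ∧ (a : ℝ) ≤ M := by
    intro A hA a ha
    have := Finset.mem_Icc.mp (hA ha)
    exact ⟨this.1, (Nat.le_floor_iff hM0.le).mp this.2⟩
  have hcard : ∀ {A : Finset ℕ}, A ⊆ Finset.Icc 1 ⌊M⌋₊ → (A.card : ℝ) ≤ M := by
    intro A hA
    have := Finset.card_le_card hA
    rw [Nat.card_Icc, Nat.add_sub_cancel] at this
    exact (Nat.le_floor_iff hM0.le).mp this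
  obtain ⟨a, ha, b, hb, hab⟩ := exists_le_neg_log_of_prod_le hξ hρ hξ1 hξ2 hprim ht hd hD hM hMD
    hDMh hdeg hlen hAne hBne (hmem hA) (hmem hB) (hcard hA) (hcard hB) hL hprod
  obtain ⟨ha0, haM⟩ := hmem hA a ha
  obtain ⟨hb0, hbM⟩ := hmem hB b hb
  have hq : 0 < a * b := Nat.mul_pos ha0 hb0
  have hqM : ((a * b : ℕ) : ℝ) ≤ M ^ 2 := by
    push_cast
    rw [sq]
    gcongr
  have hP0 : expand ℤ (a * b) Q ≠ 0 := (expand_ne_zero hq).mpr hQ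
  have hPd := natDegree_expand_le hdeg hqM
  have hPm : logMahler (expand ℤ (a * b) Q) ≤ 2 * h :=
    (logMahler_le_log_polyLength hP0).trans (log_polyLength_expand_le hQ hq hlen)
  have hPs : Real.log ‖aeval ξ (expand ℤ (a * b) Q)‖ < -(K * ((expand ℤ (a * b) Q).natDegree * h +
      logMahler (expand ℤ (a * b) Q) * (D * M ^ 2))) := by
    rw [expand_aeval]
    have h1 : K * ((expand ℤ (a * b) Q).natDegree * h +
        logMahler (expand ℤ (a * b) Q) * (D * M ^ 2)) ≤
        K * (D * M ^ 2 * h + 2 * h * (D * M ^ 2)) := by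
      gcongr
    have h2 : K * (D * M ^ 2 * h + 2 * h * (D * M ^ 2)) < L / (2 * M) := by
      rw [lt_div_iff₀ (by positivity)]
      linarith [show K * (D * M ^ 2 * h + 2 * h * (D * M ^ 2)) * (2 * M) =
        6 * K * (D * M ^ 3 * h) by ring]
    linarith
  obtain ⟨S, hS, hdvd, hs⟩ := exists_irreducible_factor hξ hP0 hPs
  refine ⟨S, hS, le_trans ?_ hPd, (logMahler_le_of_dvd hP0 hdvd).trans hPm, hs⟩
  exact_mod_cast natDegree_le_of_dvd hdvd hP0

lemma rpow_succ_le (n : ℕ) {γ τ : ℝ} (hγ : 0 ≤ γ) (hγτ : γ ≤ τ) :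
    (((n + 1 : ℕ) : ℝ) + 1) ^ γ ≤ 2 ^ τ * ((n : ℝ) + 1) ^ γ := by
  have hn : (0 : ℝ) ≤ n := Nat.cast_nonneg n
  calc (((n + 1 : ℕ) : ℝ) + 1) ^ γ ≤ (2 * ((n : ℝ) + 1)) ^ γ := by
        apply Real.rpow_le_rpow (by positivity) _ hγ
        push_cast
        linarith
    _ = 2 ^ γ * ((n : ℝ) + 1) ^ γ := Real.mul_rpow (by norm_num) (by positivity)
    _ ≤ _ := by
        gcongr
        norm_num

theorem theorem11p1 (ξ : ℂ) (hξ : Transcendental ℚ ξ) (α β μ ω : ℝ)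
    (hμ : 0 < μ) (hα : μ ≤ α) (hβ : α + μ ≤ β) (hω : α + β + (3 / 2) * μ < ω) :
    {n : ℕ | 0 < n ∧ ¬ ∃ Q : ℤ[X], IsPrimaryPoly Q ∧ NoTorsionOrZeroRoot Q ∧
      (Q.natDegree : ℝ) ≤ (n : ℝ) ^ α ∧
      intPolyHeight Q ≤ Real.exp ((n : ℝ) ^ β) ∧
      ∃ A B : Finset ℕ, A.Nonempty ∧ B.Nonempty ∧
        A ⊆ Finset.Icc 1 ⌊(n : ℝ) ^ (μ / 2)⌋₊ ∧
        B ⊆ Finset.Icc 1 ⌊(n : ℝ) ^ (μ / 2)⌋₊ ∧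
        ∏ a ∈ A, ∏ b ∈ B, ‖aeval (ξ ^ (a * b)) Q‖ ≤ Real.exp (-(n : ℝ) ^ ω)}.Infinite := by
  intro hfin
  obtain ⟨N₀, hN₀⟩ := hfin.bddAbove
  have hξ0 : ξ ≠ 0 := by
    rintro rfl
    exact hξ (isAlgebraic_zero)
  have hξpos : 0 < ‖ξ‖ := norm_pos_iff.mpr hξ0
  obtain ⟨ρ, hρ, hξ1, hξ2⟩ : ∃ ρ : ℝ, 0 ≤ ρ ∧ ‖ξ‖ ≤ Real.exp ρ ∧ Real.exp (-ρ) ≤ ‖ξ‖ := by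
    refine ⟨|Real.log ‖ξ‖|, abs_nonneg _, ?_, ?_⟩
    · rw [← Real.log_le_iff_le_exp hξpos]
      exact le_abs_self _
    · rw [← Real.le_log_iff_exp_le hξpos]
      exact neg_abs_le _
  set ε := ω - (α + β + (3 / 2) * μ) with hε
  have hε0 : 0 < ε := by linarith
  -- the sequences are shifted by one, so that they start at `1`
  set x : ℕ → ℝ := fun n ↦ (n : ℝ) + 1 with hx
  have hx1 : ∀ n, 1 ≤ x n := fun n ↦ by simp [hx]
  have hx0 : ∀ n, 0 < x n := fun n ↦ zero_lt_one.trans_le (hx1 n)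
  have hxmono : Monotone x := fun m n hmn ↦ by
    have : (m : ℝ) ≤ n := by exact_mod_cast hmn
    simpa [hx] using this
  have hxtop : Filter.Tendsto x Filter.atTop Filter.atTop :=
    Filter.tendsto_atTop_add_const_right _ _ tendsto_natCast_atTop_atTop
  -- `7` is any constant above `6`, as needed to pass from the matrix entry to a factor
  have hK : Filter.Tendsto (fun n ↦ x n ^ ε / 7) Filter.atTop Filter.atTop :=
    ((tendsto_rpow_atTop hε0).comp hxtop).atTop_div_const (by norm_num)
  obtain ⟨N₁, hN₁⟩ := Filter.eventually_atTop.mp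
    (hK.eventually_ge_atTop (2 * (19 + 6 * ρ)))
  have hmain : ∀ n ≥ max N₀ N₁, ∃ S : ℤ[X], Irreducible S ∧
      (S.natDegree : ℝ) ≤ x n ^ (α + μ) ∧ logMahler S ≤ 2 * x n ^ β ∧
      Real.log ‖aeval ξ S‖ < -(x n ^ ε / 7 *
        (S.natDegree * x n ^ β + logMahler S * x n ^ (α + μ))) := by
    intro n hn
    have hnot : ¬ (n + 1 ≤ N₀) := by
      have := (le_max_left _ _).trans hn
      omega
    obtain ⟨Q, hprim, ht, hdeg, hheight, A, B, hAne, hBne, hA, hB, hprod⟩ :=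
      not_not.mp fun hno ↦ hnot (hN₀ (a := n + 1) ⟨n.succ_pos, hno⟩)
    have hcast : ((n + 1 : ℕ) : ℝ) = x n := by simp [hx]
    rw [hcast] at hdeg hheight hA hB hprod
    have hM2 : (x n ^ (μ / 2)) ^ 2 = x n ^ μ := by
      rw [← Real.rpow_natCast, ← Real.rpow_mul (hx0 n).le]
      congr 1
      push_cast
      ring
    have hM3 : (x n ^ (μ / 2)) ^ 3 = x n ^ (3 / 2 * μ) := by
      rw [← Real.rpow_natCast, ← Real.rpow_mul (hx0 n).le]
      congr 1
      push_cast
      ring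
    have hDM : x n ^ α * (x n ^ (μ / 2)) ^ 2 = x n ^ (α + μ) := by
      rw [hM2, Real.rpow_add (hx0 n)]
    have hW : x n ^ ε * (x n ^ α * (x n ^ (μ / 2)) ^ 3 * x n ^ β) = x n ^ ω := by
      rw [hM3, ← Real.rpow_add (hx0 n), ← Real.rpow_add (hx0 n), ← Real.rpow_add (hx0 n)]
      congr 1
      rw [hε]
      ring
    have hW0 : 0 < x n ^ α * (x n ^ (μ / 2)) ^ 3 * x n ^ β := by
      have := hx0 n
      positivity
    have hxε : 0 < x n ^ ε := Real.rpow_pos_of_pos (hx0 n) _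
    have hbig := hN₁ n ((le_max_right _ _).trans hn)
    have := exists_irreducible_of_prod_le hξ hρ hξ1 hξ2 hprim ht (K := x n ^ ε / 7)
      (Real.one_le_rpow (hx1 n) (by linarith)) (Real.one_le_rpow (hx1 n) (by linarith))
      (by rw [hM2]; exact Real.rpow_le_rpow_of_exponent_le (hx1 n) hα)
      (by rw [hDM]; exact Real.rpow_le_rpow_of_exponent_le (hx1 n) hβ) hdeg hheight hAne hBne hA hB
      (by
        rw [← hW]
        gcongr
        linarith) (by positivity)
      (by
        rw [← hW]
        gcongr
        linarith) hprod
    rwa [hDM] at this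
  choose! S hS using hmain
  refine false_of_irreducible_sequence hξ (d := fun n ↦ x n ^ (α + μ)) (h := fun n ↦ x n ^ β)
    (C := 2 ^ β) (fun n ↦ Real.one_le_rpow (hx1 n) (by linarith))
    (fun n ↦ Real.rpow_le_rpow_of_exponent_le (hx1 n) hβ)
    (fun m n hmn ↦ Real.rpow_le_rpow (hx0 m).le (hxmono hmn) (by linarith))
    (fun m n hmn ↦ Real.rpow_le_rpow (hx0 m).le (hxmono hmn) (by linarith))
    (fun n ↦ rpow_succ_le n (by linarith) hβ) (fun n ↦ rpow_succ_le n (by linarith) le_rfl) hK hS
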